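/- Let $\Omega\subset\mathbb R^2$ be a bounded polygonal domain: a bounded connected open set with $\Omega=\operatorname{int}\overline\Omega$ (no slits) whose boundary is a finite union of straight segments. For a finite conforming triangulation $\mathcal T_h$ of $\Omega$ into open triangles, let its shape regularity constant be $\mathcal K(\mathcal T_h)=\max_{\tau\in\mathcal T_h}R_\tau/r_\tau$, where $r_\tau$ and $R_\tau$ are the radii of the largest circle contained in $\overline\tau$ and of the smallest circle enclosing $\tau$. Let $\mathcal E^0_h$ be the set of interior edges, let $|e|$ be the length of an edge $e$, and let $H^1_h$ be the space of (real-valued) functions $u$ on $\Omega$ with $u|_\tau\in H^1(\tau)$ for every $\tau\in\mathcal T_h$, with the norm $$\|u\|_{H^1_h}=\Big[\|u\|^2_{L^2(\Omega)}+\sum_{\tau\in\mathcal T_h}\int_\tau|\nabla u|^2+\sum_{e\in\mathcal E^0_h}\frac1{|e|}\int_e[\![u]\!]^2\Big]^{1/2},$$ where $[\![u]\!]$ is the difference of the two traces of $u$ on $e$ from the two triangles that share $e$. On $\partial\Omega$, $u$ denotes the trace taken from the adjacent triangles. Then for every $\kappa$ there is a constant $C$, depending only on $\Omega$ and $\kappa$,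 such that for every triangulation $\mathcal T_h$ of $\Omega$ with $\mathcal K(\mathcal T_h)\le\kappa$ and every $u\in H^1_h$, the trace of $u$ on $\partial\Omega$ is in $L^2(\partial\Omega)$ and $$\|u\|_{L^2(\partial\Omega)}\le C\,\|u\|_{H^1_h}.$$ -/

import Mathlib

open MeasureTheory Set Filter Topology
open scoped ContDiff ENNReal

noncomputable section

namespace PiecewiseH1

/-- The Euclidean plane. -/
abbrev Plane : Type := EuclideanSpace ℝ (Fin 2)

/-- One-dimensional (arc length) measure in the plane. -/
abbrev arcLength : Measure Plane := Measure.hausdorffMeasure 1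

/-! ### Polygonal domains -/

/-- A bounded polygonal domain: a bounded connected open set that lies on one side of its boundary
(no slits, no punctures) and whose boundary is a finite union of straight segments. Holes are
allowed, convexity is not required. -/
structure IsPolygonalDomain (Ω : Set Plane) : Prop where
  isOpen : IsOpen Ω
  isConnected : IsConnected Ω
  isBounded : Bornology.IsBounded Ω
  interior_closure : interior (closure Ω) = Ω
  frontier_eq : ∃ S : Finset (Plane × Plane), frontier Ω = ⋃ p ∈ S, segment ℝ p.1 p.2

/-! ### The Sobolev space H¹ of an open set, and traces -/

/-- `G` is the weak (distributional) gradient of `u` on the open set `U`. -/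
def IsWeakGradient (U : Set Plane) (u : Plane → ℝ) (G : Plane → Plane) : Prop :=
  ∀ φ : Plane → ℝ, ContDiff ℝ ∞ φ → HasCompactSupport φ → tsupport φ ⊆ U →
    ∀ v : Plane, ∫ x in U, u x * fderiv ℝ φ x v = -∫ x in U, inner ℝ (G x) v * φ x

/-- `u` belongs to `H¹(U)`: it is in `L²(U)` and has a weak gradient in `L²(U)`. -/
def MemH1 (U : Set Plane) (u : Plane → ℝ) : Prop :=
  MemLp u 2 (volume.restrict U) ∧
    ∃ G : Plane → Plane, MemLp G 2 (volume.restrict U) ∧ IsWeakGradient U u G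

open Classical in
/-- The square integrable weak gradient `∇u` of `u ∈ H¹(U)` (unique almost everywhere on `U`). -/
def weakGradient (U : Set Plane) (u : Plane → ℝ) : Plane → Plane :=
  if h : ∃ G : Plane → Plane, MemLp G 2 (volume.restrict U) ∧ IsWeakGradient U u G
  then h.choose else 0

/-- `g ∈ L²(∂U)` is the trace of `u` on `∂U`: there are functions, smooth up to the boundary, that
converge to `u` in `H¹(U)` and whose restrictions to `∂U` converge to `g` in `L²(∂U)`. -/
def IsTrace (U : Set Plane) (u g : Plane → ℝ) : Prop :=
  MemLp g 2 (arcLength.restrict (frontier U)) ∧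
    ∃ w : ℕ → Plane → ℝ, (∀ n, ContDiff ℝ ∞ (w n)) ∧
      Tendsto (fun n => eLpNorm (fun x => w n x - u x) 2 (volume.restrict U)) atTop (𝓝 0) ∧
      Tendsto (fun n => eLpNorm (fun x => gradient (w n) x - weakGradient U u x) 2
        (volume.restrict U)) atTop (𝓝 0) ∧
      Tendsto (fun n => eLpNorm (fun x => w n x - g x) 2 (arcLength.restrict (frontier U)))
        atTop (𝓝 0)

open Classical in
/-- The trace of `u ∈ H¹(U)` on the boundary of `U`, for `U` an open triangle. -/
def trace (U : Set Plane) (u : Plane → ℝ) : Plane → ℝ :=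
  if h : ∃ g : Plane → ℝ, IsTrace U u g then h.choose else 0

/-! ### Triangles, given by their vertex sets -/

/-- The open triangle with vertex set `s`. -/
def openTriangle (s : Finset Plane) : Set Plane := interior (convexHull ℝ (s : Set Plane))

/-- The radius of the largest circle inscribed in the triangle with vertex set `s`. -/
def inscribedRadius (s : Finset Plane) : ℝ :=
  sSup {r : ℝ | 0 ≤ r ∧ ∃ c : Plane, Metric.closedBall c r ⊆ convexHull ℝ (s : Set Plane)}

/-- The radius of the smallest circle around the triangle with vertex set `s`. -/
def circumscribedRadius (s : Finset Plane) : ℝ :=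
  sInf {R : ℝ | 0 ≤ R ∧ ∃ c : Plane, convexHull ℝ (s : Set Plane) ⊆ Metric.closedBall c R}

/-! ### Triangulations -/

/-- A (conforming, finite) triangulation of `Ω`: a finite simplicial complex, all of whose faces are
faces of triangles, which fills the closure of `Ω`. -/
structure Triangulation (Ω : Set Plane) where
  complex : Geometry.SimplicialComplex ℝ Plane
  finite_faces : complex.faces.Finite
  face_of_triangle : ∀ s ∈ complex.faces, ∃ t ∈ complex.faces, s ⊆ t ∧ t.card = 3
  space_eq : complex.space = closure Ω

namespace Triangulation

variable {Ω : Set Plane} (T : Triangulation Ω)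

/-- The elements (triangles) of the triangulation, as vertex sets. -/
def elements : Finset (Finset Plane) := {s ∈ T.finite_faces.toFinset | s.card = 3}

/-- The edges of the triangulation, as pairs of end points. -/
def edges : Finset (Finset Plane) := {e ∈ T.finite_faces.toFinset | e.card = 2}

open Classical in
/-- The elements that have `e` as an edge. -/
def elementsAt (e : Finset Plane) : Finset (Finset Plane) := {s ∈ T.elements | e ⊆ s}

/-- The interior edges: those shared by two elements. -/
def interiorEdges : Finset (Finset Plane) := {e ∈ T.edges | (T.elementsAt e).card = 2}

/-- The shape regularity constant: the maximum over the elements of the ratio of the radii of the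
circumscribed and of the inscribed circle. -/
def shapeRegularity : ℝ :=
  sSup ((fun s => circumscribedRadius s / inscribedRadius s) '' (T.elements : Set (Finset Plane)))

/-- `u` is piecewise `H¹` with respect to the triangulation. -/
def MemH1h (u : Plane → ℝ) : Prop := ∀ s ∈ T.elements, MemH1 (openTriangle s) u

/-- The square of the jump of `u` on an interior edge `e`. If `s₁`, `s₂` are the two elements that
share `e`, both mixed terms of the double sum are `(u₁ - u₂)²` and the other two vanish, so this is
`(u₁ - u₂)²`, where `uᵢ` is the trace from `sᵢ`. -/
def jumpSq (u : Plane → ℝ) (e : Finset Plane) (x : Plane) : ℝ :=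
  (1 / 2) * ∑ s ∈ T.elementsAt e, ∑ t ∈ T.elementsAt e,
    (trace (openTriangle s) u x - trace (openTriangle t) u x) ^ 2

/-- The norm of the space of piecewise `H¹` functions. For an edge `e`, a pair of points,
`Metric.diam e` is its length. -/
def H1hNorm (u : Plane → ℝ) : ℝ :=
  √((∫ x in Ω, u x ^ 2)
    + (∑ s ∈ T.elements, ∫ x in openTriangle s, ‖weakGradient (openTriangle s) u x‖ ^ 2)
    + ∑ e ∈ T.interiorEdges, (1 / Metric.diam (e : Set Plane)) *
        ∫ x in convexHull ℝ (e : Set Plane), T.jumpSq u e x ∂arcLength)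

/-- The trace of the piecewise `H¹` function `u` on `∂Ω`. A point of `∂Ω` that is not a vertex of
the triangulation lies in exactly one closed element `s` (on one of its edges), and there this is
the trace of `u` from `s`. -/
def boundaryTrace (u : Plane → ℝ) (x : Plane) : ℝ :=
  ∑ s ∈ T.elements,
    (convexHull ℝ (s : Set Plane)).indicator (trace (openTriangle s) u) x

/-- The norm of the trace of `u` in `L²(∂Ω)`. -/
def boundaryNorm (u : Plane → ℝ) : ℝ :=
  (eLpNorm (T.boundaryTrace u) 2 (arcLength.restrict (frontier Ω))).toReal

end Triangulation

end PiecewiseH1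

end

noncomputable section

namespace PiecewiseH1

/-! ### Line integrals over segments and area integrals in affine coordinates -/

/-! The inequality comes from the fundamental theorem of calculus for squares, along segments that
enter the domain. Let a triangle with vertices `c`, `d`, `q` lie in the closure of `Ω`. From the
point `c + s (d - c)` of the side, `s ≤ 1/2`, the ray `t ↦ c + s (d - c) + t (q - c)`, `t ≤ 1/2`,
stays in the triangle. The function `(1 - 2t) w²` equals `w²` at the start of the ray and vanishes
at its end, so `w²` at a boundary point is at most the integral of the derivatives along the ray
plus the jumps of `w²` at the edges that are crossed (`enorm_le_variation_add_jumps`,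
`enorm_piecewise_lineMap_le`).

Integration over `s` turns the derivatives into area integrals of `w² + |∇w|²`
(`lintegral_rays_le`). The jumps become line integrals over the edges (`exists_coarea_majorant`),
because `s` is an affine function of the point, with a Lipschitz constant that does not depend on
the edge. Young's inequality splits the jump of `w²` across an edge `e` into `|e|⁻¹` times the
squared jump of `w`, which is part of the norm, and `|e|` times squares of `w`. The latter are
absorbed by the trace inequality on one element (`diam_mul_lintegral_edge_le`), since `|e|²` is at
most `16 κ²` times the area of the element. This is where shape regularity enters.

The constant is uniform because the rays do not come from the given triangulation. They come from
one fixed triangulation of `Ω`, whose sides cover `∂Ω` (`hasBoundaryBound_frontier`); only its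
finitely many triangles, the diameter of `Ω` and `κ` enter the constant.

For `H¹` functions, contraction towards an interior point followed by mollification gives
approximations smooth up to the boundary of each triangle (`exists_smooth_approx`). The trace
inequality on the triangle makes their boundary values Cauchy, hence traces exist (`isTrace_trace`),
and every term of the inequality passes to the limit (`memLp_and_eLpNorm_boundaryTrace_le`). -/

lemma lineMap_measurableEmbedding {c d : Plane} (h : c ≠ d) :
    MeasurableEmbedding (AffineMap.lineMap c d : ℝ → Plane) := by
  have hc : Continuous (AffineMap.lineMap c d : ℝ → Plane) := AffineMap.lineMap_continuous
  exact hc.measurableEmbedding (AffineMap.lineMap_injective ℝ h)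

lemma lintegral_lineMap_image {c d : Plane} (h : c ≠ d) (S : Set ℝ)
    (f : Plane → ℝ≥0∞) :
    ∫⁻ x in AffineMap.lineMap c d '' S, f x ∂arcLength =
      ENNReal.ofReal (dist c d) * ∫⁻ r in S, f (AffineMap.lineMap c d r) := by
  have hm := lineMap_measurableEmbedding h
  have key : arcLength.restrict (AffineMap.lineMap c d '' S) =
      ENNReal.ofReal (dist c d) • (volume.restrict S).map (AffineMap.lineMap c d : ℝ → Plane) := by
    ext A hA
    rw [Measure.restrict_apply hA, Measure.smul_apply, hm.map_apply,
      Measure.restrict_apply (hm.measurable hA), ← Set.image_preimage_inter,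
      hausdorffMeasure_lineMap_image, hausdorffMeasure_real]
    simp [ENNReal.smul_def, ENNReal.ofReal, ← nndist_dist]
  rw [key, lintegral_smul_measure, hm.lintegral_map, smul_eq_mul]

lemma segment_eq_lineMap_image (c d : Plane) :
    segment ℝ c d = AffineMap.lineMap c d '' Icc (0 : ℝ) 1 :=
  segment_eq_image_lineMap ℝ c d

/-- A function on a segment, seen as a function of the value of an affine functional, integrates
to at most the Lipschitz constant times its line integral. -/
lemma exists_coarea_majorant (σ : Plane →ᵃ[ℝ] ℝ) {L : ℝ}
    (hL : ∀ x y, |σ x - σ y| ≤ L * dist x y) (c d : Plane)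
    {F : Plane → ℝ≥0∞} (hF : Measurable F) :
    ∃ Φ : ℝ → ℝ≥0∞, Measurable Φ ∧
      ∫⁻ s, Φ s ≤ ENNReal.ofReal L * ∫⁻ x in segment ℝ c d, F x ∂arcLength ∧
      ∀ᵐ s : ℝ, ∀ x ∈ segment ℝ c d, σ x = s → F x ≤ Φ s := by
  have hσ : ∀ r : ℝ, σ (AffineMap.lineMap c d r) = σ c + r * (σ d - σ c) := by
    intro r
    rw [AffineMap.apply_lineMap, AffineMap.lineMap_apply]
    simp [add_comm]
  -- If `σ` is constant on the segment, only one value of `s` is attained; it is a null set, so the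
  -- zero majorant suffices.
  by_cases hcd : σ c = σ d
  · refine ⟨0, measurable_zero, by simp, ?_⟩
    have : ∀ᵐ s : ℝ, s ≠ σ c := by simp [ae_iff]
    filter_upwards [this] with s hs x hx hxs
    rw [segment_eq_lineMap_image] at hx
    obtain ⟨r, -, rfl⟩ := hx
    rw [hσ, hcd] at hxs
    rw [hcd] at hs
    exact absurd (by simpa using hxs.symm) hs
  have hne : c ≠ d := fun h => hcd (by rw [h])
  set a := σ d - σ c with ha
  have ha0 : a ≠ 0 := sub_ne_zero.2 (Ne.symm hcd)
  set g : ℝ → ℝ≥0∞ := (Icc (0:ℝ) 1).indicator fun r => F (AffineMap.lineMap c d r) with hg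
  have hgm : Measurable g := (hF.comp (lineMap_measurableEmbedding hne).measurable).indicator
    measurableSet_Icc
  -- Each level meets the segment in at most one point, and the majorant is `F` there. Its integral
  -- gains the factor `|a| ≤ L * dist c d`, where `dist c d` is the speed of the parametrization.
  refine ⟨fun s => g (a⁻¹ * (s - σ c)), hgm.comp (by fun_prop), ?_, ?_⟩
  · have e1 : ∫⁻ s, g (a⁻¹ * (s - σ c)) = ∫⁻ s, g (a⁻¹ * s) :=
      lintegral_sub_right_eq_self (μ := volume) (fun s => g (a⁻¹ * s)) (σ c)
    have e2 : ∫⁻ s, g (a⁻¹ * s) = ENNReal.ofReal |a| * ∫⁻ s, g s := by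
      rw [← lintegral_map hgm (measurable_const_mul a⁻¹),
        Real.map_volume_mul_left (inv_ne_zero ha0), lintegral_smul_measure, inv_inv, smul_eq_mul]
    rw [e1, e2, hg, lintegral_indicator measurableSet_Icc, segment_eq_lineMap_image,
      lintegral_lineMap_image hne, ← mul_assoc]
    gcongr
    rw [← ENNReal.ofReal_mul' dist_nonneg]
    apply ENNReal.ofReal_le_ofReal
    rw [dist_comm]
    exact hL d c
  · refine Eventually.of_forall fun s x hx hxs => ?_
    rw [segment_eq_lineMap_image] at hx
    obtain ⟨r, hr, rfl⟩ := hx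
    rw [hσ] at hxs
    have : a⁻¹ * (s - σ c) = r := by rw [← hxs]; field_simp; ring
    simp only [this, hg, indicator_of_mem hr, le_refl]

/-- The plane in affine coordinates. -/
def affineCoords (c v w : Plane) (p : ℝ × ℝ) : Plane := c + (p.1 • v + p.2 • w)

lemma continuous_affineCoords (c v w : Plane) : Continuous (affineCoords c v w) := by
  unfold affineCoords; fun_prop

/-- The push-forward of Lebesgue measure under a linear isomorphism is again a Haar measure, hence a
multiple of `volume`. The value of `K` is bounded later, by testing with a triangle. -/
lemma exists_lintegral_affineCoords (c : Plane) {v w : Plane} (h : LinearIndependent ℝ ![v, w]) :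
    ∃ K : ℝ≥0∞, ∀ f : Plane → ℝ≥0∞, ∫⁻ p, f (affineCoords c v w p) = K * ∫⁻ x, f x := by
  have hfr : Module.finrank ℝ (ℝ × ℝ) = Module.finrank ℝ Plane := by simp
  let Λ : ℝ × ℝ →ₗ[ℝ] Plane :=
    (LinearMap.fst ℝ ℝ ℝ).smulRight v + (LinearMap.snd ℝ ℝ ℝ).smulRight w
  have hΛ : ∀ p, Λ p = p.1 • v + p.2 • w := fun p => rfl
  have hinj : Function.Injective Λ := by
    rw [← LinearMap.ker_eq_bot, LinearMap.ker_eq_bot']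
    intro p hp
    rw [hΛ] at hp
    obtain ⟨h1, h2⟩ := LinearIndependent.pair_iff.1 h _ _ hp
    exact Prod.ext h1 h2
  let e : (ℝ × ℝ) ≃L[ℝ] Plane := (LinearEquiv.ofInjectiveOfFinrankEq Λ hinj hfr).toContinuousLinearEquiv
  have he : ∀ p, e p = p.1 • v + p.2 • w := fun p => rfl
  have : Measure.IsAddHaarMeasure ((volume : Measure (ℝ × ℝ)).map e) := inferInstance
  obtain ⟨K, hsm⟩ : ∃ K : NNReal, (volume : Measure (ℝ × ℝ)).map e = K • volume :=
    ⟨_, Measure.isAddLeftInvariant_eq_smul _ _⟩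
  refine ⟨K, fun f => ?_⟩
  have hme : MeasurableEmbedding e := e.toHomeomorph.measurableEmbedding
  calc ∫⁻ p, f (affineCoords c v w p) = ∫⁻ p, f (c + e p) := by simp [affineCoords, he]
    _ = ∫⁻ x, f (c + x) ∂((volume : Measure (ℝ × ℝ)).map e) := by rw [hme.lintegral_map]
    _ = _ := by
      rw [hsm, lintegral_smul_measure, lintegral_add_left_eq_self]
      rfl

/-- The area formula for affine coordinates on a triangle, as an inequality. -/
lemma lintegral_affineCoords_le (c : Plane) {v w : Plane} (h : LinearIndependent ℝ ![v, w])
    (f : Plane → ℝ≥0∞) :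
    ∫⁻ p, f (affineCoords c v w p) ≤
      (volume (convexHull ℝ {c, c + v, c + w}))⁻¹ * ∫⁻ x, f x := by
  obtain ⟨K, hK⟩ := exists_lintegral_affineCoords c h
  rw [hK]
  gcongr
  rw [ENNReal.le_inv_iff_mul_le]
  set S : Set Plane := convexHull ℝ {c, c + v, c + w} with hS
  have hSm : MeasurableSet S := by
    have : ({c, c + v, c + w} : Set Plane).Finite := by simp
    exact (this.isCompact_convexHull (𝕜 := ℝ)).isClosed.measurableSet
  -- Tested on the indicator of the triangle, `K * volume S` is the area of a set of coordinates
  -- contained in the unit square, so it is at most `1`.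
  have h1 := hK (S.indicator 1)
  rw [lintegral_indicator_one hSm] at h1
  rw [← h1]
  have hsub : ∀ p, S.indicator (1 : Plane → ℝ≥0∞) (affineCoords c v w p) ≤
      (Icc (0:ℝ) 1 ×ˢ Icc (0:ℝ) 1).indicator (1 : ℝ × ℝ → ℝ≥0∞) p := by
    intro p
    by_cases hp : affineCoords c v w p ∈ S
    · have : p ∈ Icc (0:ℝ) 1 ×ˢ Icc (0:ℝ) 1 := by
        rw [hS, convexHull_insert (𝕜 := ℝ) (by simp), convexHull_pair] at hp
        simp only [mem_convexJoin, mem_singleton_iff, exists_eq_left] at hp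
        obtain ⟨y, hy, hp⟩ := hp
        obtain ⟨a, b, ha, hb, hab, rfl⟩ := hy
        obtain ⟨a', b', ha', hb', hab', hp⟩ := hp
        have e0 : (p.1 - b' * a) • v + (p.2 - b' * b) • w = 0 := by
          have e3 : a' • c + b' • (a • (c + v) + b • (c + w)) =
              c + ((b' * a) • v + (b' * b) • w) := by
            obtain rfl : a = 1 - b := by linarith
            obtain rfl : a' = 1 - b' := by linarith
            module
          rw [e3] at hp
          unfold affineCoords at hp
          have := add_left_cancel hp
          rw [sub_smul, sub_smul]
          rw [sub_add_sub_comm, ← this, sub_self]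
        obtain ⟨h1, h2⟩ := LinearIndependent.pair_iff.1 h _ _ e0
        refine ⟨⟨?_, ?_⟩, ⟨?_, ?_⟩⟩ <;> nlinarith
      rw [indicator_of_mem hp, indicator_of_mem this]
      rfl
    · simp [indicator_of_notMem hp]
  refine (lintegral_mono hsub).trans ?_
  rw [lintegral_indicator_one (measurableSet_Icc.prod measurableSet_Icc), Measure.volume_eq_prod,
    Measure.prod_prod]
  simp

/-! ### Functions along a segment that is covered by finitely many intervals -/

/-- A family of functions on closed intervals that cover `[0, b]` and that vanish at `b`: at `0`
they are bounded by their total variations and by the jumps between them. -/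
lemma enorm_le_variation_add_jumps {ι : Type*} [DecidableEq ι] (A : Finset ι) (I : ι → Set ℝ)
    {b : ℝ}
    (hcl : ∀ i ∈ A, IsClosed (I i)) (hord : ∀ i ∈ A, (I i).OrdConnected)
    (hsub : ∀ i ∈ A, I i ⊆ Icc 0 b) (hcov : Icc 0 b ⊆ ⋃ i ∈ A, I i)
    (f : ι → ℝ → ℝ) (hf : ∀ i ∈ A, ContDiff ℝ 1 (f i)) (hfb : ∀ i ∈ A, f i b = 0)
    (J : ι → ι → ℝ≥0∞)
    (hJ : ∀ k ∈ A, ∀ l ∈ A, k ≠ l → ∀ t ∈ I k, t ∈ I l → ‖f k t - f l t‖ₑ ≤ J k l)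
    {i : ι} (hi : i ∈ A) (h0 : 0 ∈ I i) :
    ‖f i 0‖ₑ ≤ ∑ k ∈ A, (∫⁻ t in I k, ‖deriv (f k) t‖ₑ) +
      ∑ k ∈ A, ∑ l ∈ A, if k ≠ l then J k l else 0 := by
  set β : ι → ℝ := fun k => sSup (I k) with hβ
  have hbdd : ∀ k ∈ A, BddAbove (I k) := fun k hk => bddAbove_Icc.mono (hsub k hk)
  have hβmem : ∀ k ∈ A, (I k).Nonempty → β k ∈ I k := fun k hk hne =>
    (hcl k hk).csSup_mem hne (hbdd k hk)
  -- Induction on the number of intervals whose right end lies beyond that of `I i`. The right-hand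
  -- side contains only intervals that end at `β i` or later, so each interval is charged at most
  -- once.
  have main : ∀ n : ℕ, ∀ i ∈ A, (A.filter fun k => β i < β k).card < n → ∀ t ∈ I i,
      ‖f i t‖ₑ ≤ ∑ k ∈ A with β i ≤ β k, ((∫⁻ t in I k, ‖deriv (f k) t‖ₑ) +
        ∑ l ∈ A, if k ≠ l then J k l else 0) := by
    intro n
    induction n with
    | zero => intro i _ h; simp at h
    | succ n ih =>
      intro i hi hn t ht
      have hne : (I i).Nonempty := ⟨t, ht⟩
      have hβi := hβmem i hi hne
      have htβ : t ≤ β i := le_csSup (hbdd i hi) ht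
      have h1 : ‖f i t‖ₑ ≤ (∫⁻ t in I i, ‖deriv (f i) t‖ₑ) + ‖f i (β i)‖ₑ := by
        have h2 := enorm_sub_le_lintegral_deriv_of_contDiffOn_Icc (hf i hi).contDiffOn htβ
        have h3 : ∫⁻ x in Icc t (β i), ‖deriv (f i) x‖ₑ ≤ ∫⁻ t in I i, ‖deriv (f i) t‖ₑ :=
          lintegral_mono_set ((hord i hi).out ht hβi)
        calc ‖f i t‖ₑ = ‖f i (β i) - (f i (β i) - f i t)‖ₑ := by rw [sub_sub_cancel]
          _ ≤ ‖f i (β i)‖ₑ + ‖f i (β i) - f i t‖ₑ := enorm_sub_le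
          _ ≤ _ := by rw [add_comm]; gcongr; exact h2.trans h3
      by_cases hib : β i = b
      · rw [hib, hfb i hi, enorm_zero, add_zero] at h1
        refine h1.trans (le_trans le_self_add (Finset.single_le_sum (f := fun k =>
          ((∫⁻ t in I k, ‖deriv (f k) t‖ₑ) + ∑ l ∈ A, if k ≠ l then J k l else 0))
          (fun _ _ => zero_le) (by simp [hi] : i ∈ A.filter fun k => β i ≤ β k)))
      have hib' : β i < b := lt_of_le_of_ne (hsub i hi hβi).2 hib
      -- Finitely many intervals cover a right neighbourhood of `β i`, so one of them accumulates at
      -- `β i` from the right. Being closed it contains `β i`, and it ends strictly later: the path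
      -- switches to it.
      obtain ⟨l, hl, hll⟩ : ∃ l ∈ A, ∃ᶠ x in 𝓝[>] (β i), x ∈ I l := by
        by_contra hcon
        push Not at hcon
        have : ∀ᶠ x in 𝓝[>] (β i), ∀ l ∈ A, x ∉ I l := by
          rw [Filter.eventually_all_finset]; exact hcon
        obtain ⟨x, hx1, hx2⟩ := (this.and (Ioc_mem_nhdsGT hib')).exists
        have := hcov ⟨(hsub i hi hβi).1.trans hx2.1.le, hx2.2⟩
        simp only [mem_iUnion] at this
        obtain ⟨l, hl, hxl⟩ := this
        exact hx1 l hl hxl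
      have hβl : β i ∈ I l := by
        refine (hcl l hl).closure_subset ?_
        exact mem_closure_iff_frequently.2 (hll.filter_mono nhdsWithin_le_nhds)
      have hlt : β i < β l := by
        obtain ⟨x, hx1, hx2⟩ := (hll.and_eventually self_mem_nhdsWithin).exists
        exact lt_of_lt_of_le hx2 (le_csSup (hbdd l hl) hx1)
      have hil : i ≠ l := by rintro rfl; exact lt_irrefl _ hlt
      have h4 := ih l hl (by
        refine lt_of_lt_of_le (Finset.card_lt_card ?_) (Nat.le_of_lt_succ hn)
        refine Finset.ssubset_iff_subset_ne.2 ⟨?_, ?_⟩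
        · intro k hk
          simp only [Finset.mem_filter] at hk ⊢
          exact ⟨hk.1, hlt.trans hk.2⟩
        · intro h
          have : l ∈ A.filter fun k => β i < β k := by simp [hl, hlt]
          rw [← h] at this
          simp at this) (β i) hβl
      have h5 : ‖f i (β i)‖ₑ ≤ J i l + ‖f l (β i)‖ₑ := by
        calc ‖f i (β i)‖ₑ = ‖(f i (β i) - f l (β i)) + f l (β i)‖ₑ := by rw [sub_add_cancel]
          _ ≤ _ := (enorm_add_le _ _).trans (by gcongr; exact hJ i hi l hl hil _ hβi hβl)
      have h6 : J i l ≤ ∑ l ∈ A, if i ≠ l then J i l else 0 := by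
        refine le_trans (le_of_eq ?_) (Finset.single_le_sum (f := fun l => if i ≠ l then J i l
          else 0) (fun _ _ => zero_le) hl)
        simp [hil]
      calc ‖f i t‖ₑ ≤ ((∫⁻ t in I i, ‖deriv (f i) t‖ₑ) + ∑ l ∈ A, if i ≠ l then J i l else 0) +
            ∑ k ∈ A with β l ≤ β k, ((∫⁻ t in I k, ‖deriv (f k) t‖ₑ) +
              ∑ l ∈ A, if k ≠ l then J k l else 0) := by
            refine h1.trans ?_
            rw [add_assoc]
            gcongr
            exact h5.trans (add_le_add h6 h4)
        _ = ∑ k ∈ insert i (A.filter fun k => β l ≤ β k), ((∫⁻ t in I k, ‖deriv (f k) t‖ₑ) +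
              ∑ l ∈ A, if k ≠ l then J k l else 0) := by
            rw [Finset.sum_insert (by simp [hlt])]
        _ ≤ _ := by
            apply Finset.sum_le_sum_of_subset
            intro k hk
            simp only [Finset.mem_insert, Finset.mem_filter] at hk ⊢
            rcases hk with rfl | hk
            · exact ⟨hi, le_rfl⟩
            · exact ⟨hk.1, hlt.le.trans hk.2⟩
  refine (main _ i hi (Nat.lt_succ_self _) 0 h0).trans ?_
  rw [← Finset.sum_add_distrib]
  exact Finset.sum_le_sum_of_subset (Finset.filter_subset _ _)

/-! ### Smooth functions along the segments of a parallelogram -/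

/-- The integrand of the square of the `H¹` norm. -/
def energyDensity (w : Plane → ℝ) (x : Plane) : ℝ≥0∞ := ‖w x‖ₑ ^ 2 + ‖gradient w x‖ₑ ^ 2

lemma continuous_gradient {w : Plane → ℝ} (hw : ContDiff ℝ 1 w) : Continuous (gradient w) := by
  unfold gradient
  exact (LinearIsometryEquiv.continuous _).comp (hw.continuous_fderiv one_ne_zero)

lemma measurable_energyDensity {w : Plane → ℝ} (hw : ContDiff ℝ 1 w) :
    Measurable (energyDensity w) := by
  unfold energyDensity
  exact (hw.continuous.measurable.enorm.pow_const 2).add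
    ((continuous_gradient hw).measurable.enorm.pow_const 2)

/-- The square of `w` along a coordinate segment, with a weight that vanishes at the far end. -/
def rayFun (c v z : Plane) (w : Plane → ℝ) (s t : ℝ) : ℝ :=
  (1 - 2 * t) * w (affineCoords c v z (s, t)) ^ 2

lemma contDiff_rayFun (c v z : Plane) {w : Plane → ℝ} (hw : ContDiff ℝ 1 w) (s : ℝ) :
    ContDiff ℝ 1 (rayFun c v z w s) := by
  unfold rayFun affineCoords
  fun_prop

lemma rayFun_zero (c v z : Plane) (w : Plane → ℝ) (s : ℝ) :
    rayFun c v z w s 0 = w (c + s • v) ^ 2 := by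
  simp [rayFun, affineCoords]

lemma rayFun_half (c v z : Plane) (w : Plane → ℝ) (s : ℝ) : rayFun c v z w s (1 / 2) = 0 := by
  simp [rayFun]

/-- The derivative is `-2w² + (1 - 2t) 2w ∂w`. As `|1 - 2t| ≤ 1` and `2 |w| |∇w| D ≤ w² + D² |∇w|²`,
it is at most `3w² + D² |∇w|²`. -/
lemma enorm_deriv_rayFun_le (c v z : Plane) {w : Plane → ℝ} (hw : ContDiff ℝ 1 w) {D : ℝ}
    (hD : ‖z‖ ≤ D) (s : ℝ) {t : ℝ} (ht : t ∈ Icc (0:ℝ) (1 / 2)) :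
    ‖deriv (rayFun c v z w s) t‖ₑ ≤
      ENNReal.ofReal (3 + D ^ 2) * energyDensity w (affineCoords c v z (s, t)) := by
  set x := affineCoords c v z (s, t) with hx
  have h1 : HasDerivAt (fun t => affineCoords c v z (s, t)) z t := by
    unfold affineCoords
    simpa using (((hasDerivAt_id t).smul_const z).const_add (s • v)).const_add c
  have h2 : HasDerivAt (fun t => w (affineCoords c v z (s, t))) (fderiv ℝ w x z) t :=
    (hw.differentiable one_ne_zero x).hasFDerivAt.comp_hasDerivAt t h1
  have h3 : HasDerivAt (rayFun c v z w s)
      (-2 * w x ^ 2 + (1 - 2 * t) * (2 * w x * fderiv ℝ w x z)) t := by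
    have h4 : HasDerivAt (fun t : ℝ => 1 - 2 * t) (-2) t := by
      simpa using ((hasDerivAt_id t).const_mul 2).const_sub 1
    have := h4.mul (h2.pow 2)
    convert! this using 1
    simp only [Pi.pow_apply, ← hx]
    norm_num
  rw [h3.deriv]
  have hg : ‖gradient w x‖ = ‖fderiv ℝ w x‖ := by simp [gradient]
  have h5 : |fderiv ℝ w x z| ≤ ‖gradient w x‖ * D := by
    rw [hg]
    exact ((fderiv ℝ w x).le_opNorm z).trans (by gcongr)
  have hreal : |(-2 * w x ^ 2 + (1 - 2 * t) * (2 * w x * fderiv ℝ w x z))| ≤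
      (3 + D ^ 2) * (‖w x‖ ^ 2 + ‖gradient w x‖ ^ 2) := by
    set F := fderiv ℝ w x z
    set g := ‖gradient w x‖
    have h01 : |1 - 2 * t| ≤ 1 := by rw [abs_le]; constructor <;> linarith [ht.1, ht.2]
    have h6 : |(1 - 2 * t) * (2 * w x * F)| ≤ 2 * |w x| * (g * D) := by
      rw [abs_mul, abs_mul, abs_mul, abs_two]
      have : 2 * |w x| * |F| ≤ 2 * |w x| * (g * D) := by gcongr
      have h0 : 0 ≤ 2 * |w x| * |F| := by positivity
      nlinarith
    have h7 : 2 * |w x| * (g * D) ≤ w x ^ 2 + g ^ 2 * D ^ 2 := by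
      nlinarith [sq_nonneg (|w x| - g * D), sq_abs (w x)]
    have h8 : |(-2 * w x ^ 2)| = 2 * w x ^ 2 := by
      rw [abs_mul, abs_of_nonneg (sq_nonneg (w x))]; norm_num
    rw [Real.norm_eq_abs, sq_abs]
    refine (abs_add_le _ _).trans ?_
    rw [h8]
    nlinarith [sq_nonneg (w x), sq_nonneg g, mul_nonneg (sq_nonneg D) (sq_nonneg (w x)),
      sq_nonneg D]
  rw [Real.enorm_eq_ofReal_abs, energyDensity, ← ofReal_norm (w x), ← ofReal_norm (gradient w x),
    ← ENNReal.ofReal_pow (norm_nonneg _), ← ENNReal.ofReal_pow (norm_nonneg _),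
    ← ENNReal.ofReal_add (by positivity) (by positivity), ← ENNReal.ofReal_mul (by positivity)]
  exact ENNReal.ofReal_le_ofReal hreal

/-- Integration over the coordinate segments inside `K`, compared with integration over `K`. -/
lemma lintegral_rays_le (c : Plane) {v z : Plane} (h : LinearIndependent ℝ ![v, z])
    {K : Set Plane} (hK : MeasurableSet K) {g : Plane → ℝ≥0∞} (hg : Measurable g) :
    ∫⁻ s in Icc (0:ℝ) (1 / 2), ∫⁻ t in {t | t ∈ Icc (0:ℝ) (1 / 2) ∧ affineCoords c v z (s, t) ∈ K},
        g (affineCoords c v z (s, t)) ≤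
      (volume (convexHull ℝ {c, c + v, c + z}))⁻¹ * ∫⁻ x in K, g x := by
  have hm : Measurable (affineCoords c v z) := (continuous_affineCoords c v z).measurable
  rw [← lintegral_indicator hK]
  refine le_trans ?_ (lintegral_affineCoords_le c h (K.indicator g))
  rw [Measure.volume_eq_prod, lintegral_prod (fun p => K.indicator g (affineCoords c v z p))
    ((hg.indicator hK).comp hm).aemeasurable]
  refine (setLIntegral_le_lintegral _ _).trans (lintegral_mono fun s => ?_)
  have hms : MeasurableSet {t : ℝ | affineCoords c v z (s, t) ∈ K} :=
    (hm.comp measurable_prodMk_left) hK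
  have hms' : MeasurableSet {t | t ∈ Icc (0:ℝ) (1 / 2) ∧ affineCoords c v z (s, t) ∈ K} :=
    measurableSet_Icc.inter hms
  rw [← lintegral_indicator hms']
  refine lintegral_mono fun t => ?_
  by_cases ht : t ∈ {t | t ∈ Icc (0:ℝ) (1 / 2) ∧ affineCoords c v z (s, t) ∈ K}
  · rw [indicator_of_mem ht, indicator_of_mem ht.2]
  · rw [indicator_of_notMem ht]; exact zero_le

lemma affineCoords_mem_convexHull (c v z : Plane) {s t : ℝ} (hs : 0 ≤ s) (ht : 0 ≤ t)
    (hst : s + t ≤ 1) : affineCoords c v z (s, t) ∈ convexHull ℝ {c, c + v, c + z} := by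
  have hc := convex_convexHull ℝ ({c, c + v, c + z} : Set Plane)
  have h1 : c ∈ convexHull ℝ ({c, c + v, c + z} : Set Plane) := subset_convexHull _ _ (by simp)
  have h2 : c + v ∈ convexHull ℝ ({c, c + v, c + z} : Set Plane) := subset_convexHull _ _ (by simp)
  have h3 : c + z ∈ convexHull ℝ ({c, c + v, c + z} : Set Plane) := subset_convexHull _ _ (by simp)
  have h4 := hc.sum_mem (t := Finset.univ) (w := ![1 - s - t, s, t]) (z := ![c, c + v, c + z])
    (by intro i _; fin_cases i <;> simp <;> linarith)
    (by simp [Fin.sum_univ_three]; ring)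
    (by intro i _; fin_cases i <;> simpa)
  convert h4 using 1
  simp [Fin.sum_univ_three, affineCoords]
  module

/-- A local trace inequality, on one half of a side of a triangle. -/
lemma lintegral_half_side_le (c : Plane) {v z : Plane} (h : LinearIndependent ℝ ![v, z])
    {w : Plane → ℝ} (hw : ContDiff ℝ 1 w) {D : ℝ} (hD : ‖z‖ ≤ D) :
    ∫⁻ s in Icc (0:ℝ) (1 / 2), ‖w (c + s • v)‖ₑ ^ 2 ≤
      (volume (convexHull ℝ {c, c + v, c + z}))⁻¹ * (ENNReal.ofReal (3 + D ^ 2) *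
        ∫⁻ x in convexHull ℝ {c, c + v, c + z}, energyDensity w x) := by
  have hK : MeasurableSet (convexHull ℝ ({c, c + v, c + z} : Set Plane)) := by
    have : ({c, c + v, c + z} : Set Plane).Finite := by simp
    exact (this.isCompact_convexHull (𝕜 := ℝ)).isClosed.measurableSet
  rw [← lintegral_const_mul _ (measurable_energyDensity hw)]
  refine le_trans ?_ (lintegral_rays_le c h hK ((measurable_energyDensity hw).const_mul _))
  refine setLIntegral_mono' measurableSet_Icc fun s hs => ?_
  -- For `s, t ≤ 1/2` the ray stays inside the triangle, so the restriction to the triangle removes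
  -- nothing.
  have hset : {t | t ∈ Icc (0:ℝ) (1 / 2) ∧ affineCoords c v z (s, t) ∈
      convexHull ℝ {c, c + v, c + z}} = Icc (0:ℝ) (1 / 2) := by
    ext t
    refine ⟨fun ht => ht.1, fun ht => ⟨ht, affineCoords_mem_convexHull c v z hs.1 ht.1 ?_⟩⟩
    linarith [hs.2, ht.2]
  rw [hset]
  have h1 := enorm_sub_le_lintegral_deriv_of_contDiffOn_Icc
    (contDiff_rayFun c v z hw s).contDiffOn (by norm_num : (0:ℝ) ≤ 1 / 2)
  rw [rayFun_half, zero_sub, enorm_neg, rayFun_zero, enorm_pow] at h1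
  exact h1.trans (setLIntegral_mono' measurableSet_Icc fun t ht =>
    enorm_deriv_rayFun_le c v z hw hD s ht)

/-- Rays of parameter length `1/2` parallel to `q - c` stay in the triangle only when they start in
the half of the side near `c`. The other half is treated with `c` and `d` exchanged. -/
lemma segment_subset_halves (c d : Plane) :
    segment ℝ c d ⊆ AffineMap.lineMap c d '' Icc (0 : ℝ) (1 / 2) ∪
      AffineMap.lineMap d c '' Icc (0 : ℝ) (1 / 2) := by
  rw [segment_eq_lineMap_image]
  rintro _ ⟨r, hr, rfl⟩
  by_cases h : r ≤ 1 / 2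
  · exact Or.inl ⟨r, ⟨hr.1, h⟩, rfl⟩
  · refine Or.inr ⟨1 - r, ⟨by linarith [hr.2], by linarith⟩, ?_⟩
    rw [AffineMap.lineMap_apply_one_sub]

lemma linearIndependent_sides {c d q : Plane} (h : AffineIndependent ℝ ![c, d, q]) :
    LinearIndependent ℝ ![d - c, q - c] := by
  rw [affineIndependent_iff_linearIndependent_vsub ℝ _ (0 : Fin 3)] at h
  have := h.comp (fun i : Fin 2 => ⟨i.succ, Fin.succ_ne_zero i⟩) (by
    intro i j hij; simpa using hij)
  have e : ![d - c, q - c] = ((fun i : {x : Fin 3 // x ≠ 0} => ![c, d, q] i -ᵥ ![c, d, q] 0) ∘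
      fun i : Fin 2 => ⟨i.succ, Fin.succ_ne_zero i⟩) := by
    ext i
    fin_cases i <;> simp
  rw [e]
  exact this

lemma lintegral_half_segment_le {c d q : Plane} (h : AffineIndependent ℝ ![c, d, q])
    {w : Plane → ℝ} (hw : ContDiff ℝ 1 w) {D : ℝ} (hD : dist c q ≤ D) :
    ∫⁻ x in AffineMap.lineMap c d '' Icc (0 : ℝ) (1 / 2), ‖w x‖ₑ ^ 2 ∂arcLength ≤
      ENNReal.ofReal (dist c d) * ((volume (convexHull ℝ {c, d, q}))⁻¹ *
        (ENNReal.ofReal (3 + D ^ 2) * ∫⁻ x in convexHull ℝ {c, d, q}, energyDensity w x)) := by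
  have hcd : c ≠ d := fun hcd => by
    have := h.injective.ne (by decide : (0 : Fin 3) ≠ 1); exact this hcd
  rw [lintegral_lineMap_image hcd]
  gcongr
  have := lintegral_half_side_le c (linearIndependent_sides h) hw (D := D)
    (by rwa [← dist_eq_norm, dist_comm])
  simpa [AffineMap.lineMap_apply, add_comm] using this

/-- The local trace inequality, on a side of a triangle. -/
lemma lintegral_side_le {c d q : Plane} (h : AffineIndependent ℝ ![c, d, q])
    {w : Plane → ℝ} (hw : ContDiff ℝ 1 w) {D : ℝ} (hD : dist c q ≤ D) (hD' : dist d q ≤ D) :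
    ∫⁻ x in segment ℝ c d, ‖w x‖ₑ ^ 2 ∂arcLength ≤
      2 * (ENNReal.ofReal (dist c d) * ((volume (convexHull ℝ {c, d, q}))⁻¹ *
        (ENNReal.ofReal (3 + D ^ 2) * ∫⁻ x in convexHull ℝ {c, d, q}, energyDensity w x))) := by
  have h' : AffineIndependent ℝ ![d, c, q] := by
    have := h.comp_embedding (Equiv.swap (0 : Fin 3) 1).toEmbedding
    convert this using 1
    ext i
    fin_cases i <;> simp [Equiv.swap_apply_def]
  refine (lintegral_mono_set (segment_subset_halves c d)).trans ?_
  refine (lintegral_union_le _ _ _).trans ?_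
  rw [two_mul]
  refine add_le_add (lintegral_half_segment_le h hw hD) ?_
  have := lintegral_half_segment_le h' hw hD'
  rwa [dist_comm d c, insert_comm d c] at this

/-! ### Barycentric coordinates on triangles -/

lemma exists_affineBasis_triangle {c d q : Plane} (h : AffineIndependent ℝ ![c, d, q]) :
    ∃ b : AffineBasis (Fin 3) ℝ Plane, ⇑b = ![c, d, q] :=
  ⟨⟨_, h, h.affineSpan_eq_top_iff_card_eq_finrank_add_one.2 (by simp)⟩, rfl⟩

lemma range_triangle (c d q : Plane) : range ![c, d, q] = {c, d, q} := by
  ext x; simp [eq_comm]; tauto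

lemma convexHull_triangle {c d q : Plane} {b : AffineBasis (Fin 3) ℝ Plane}
    (hb : ⇑b = ![c, d, q]) :
    convexHull ℝ ({c, d, q} : Set Plane) = {x | ∀ i, 0 ≤ b.coord i x} := by
  rw [← b.convexHull_eq_nonneg_coord, hb, range_triangle]

lemma interior_triangle {c d q : Plane} {b : AffineBasis (Fin 3) ℝ Plane}
    (hb : ⇑b = ![c, d, q]) :
    interior (convexHull ℝ ({c, d, q} : Set Plane)) = {x | ∀ i, 0 < b.coord i x} := by
  rw [← b.interior_convexHull, hb, range_triangle]

lemma coord_lineMap (b : AffineBasis (Fin 3) ℝ Plane) (i : Fin 3) (x y : Plane) (r : ℝ) :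
    b.coord i (AffineMap.lineMap x y r) = (1 - r) * b.coord i x + r * b.coord i y := by
  rw [AffineMap.apply_lineMap, AffineMap.lineMap_apply]
  simp; ring

lemma interior_triangle_nonempty {c d q : Plane} (h : AffineIndependent ℝ ![c, d, q]) :
    (interior (convexHull ℝ ({c, d, q} : Set Plane))).Nonempty := by
  obtain ⟨b, hb⟩ := exists_affineBasis_triangle h
  rw [← range_triangle, ← hb]
  exact ⟨_, b.centroid_mem_interior_convexHull⟩

lemma frontier_interior_triangle {c d q : Plane} (h : AffineIndependent ℝ ![c, d, q]) :
    frontier (interior (convexHull ℝ ({c, d, q} : Set Plane))) =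
      convexHull ℝ {c, d, q} \ interior (convexHull ℝ {c, d, q}) := by
  have hcl : IsClosed (convexHull ℝ ({c, d, q} : Set Plane)) := by
    have : ({c, d, q} : Set Plane).Finite := by simp
    exact (this.isCompact_convexHull (𝕜 := ℝ)).isClosed
  rw [frontier, interior_interior,
    (convex_convexHull ℝ _).closure_interior_eq_closure_of_nonempty_interior
      (interior_triangle_nonempty h), hcl.closure_eq]

/-- A point of a triangle whose third barycentric coordinate vanishes is on the opposite side. -/
lemma mem_segment_of_coord_eq_zero {c d q : Plane} {b : AffineBasis (Fin 3) ℝ Plane}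
    (hb : ⇑b = ![c, d, q]) {x : Plane} (h0 : 0 ≤ b.coord 0 x) (h1 : 0 ≤ b.coord 1 x)
    (h2 : b.coord 2 x = 0) : x ∈ segment ℝ c d := by
  have hs := b.sum_coord_apply_eq_one x
  have hx := b.linear_combination_coord_eq_self x
  rw [Fin.sum_univ_three] at hs hx
  rw [h2, hb] at hx
  rw [h2] at hs
  exact ⟨_, _, h0, h1, by linarith, by simpa using hx⟩

lemma affineIndependent_rotate {c d q : Plane} (h : AffineIndependent ℝ ![c, d, q]) :
    AffineIndependent ℝ ![d, q, c] := by
  have := h.comp_embedding (finRotate 3).toEmbedding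
  have e : ![d, q, c] = (![c, d, q] ∘ (finRotate 3).toEmbedding) := by
    ext i j
    fin_cases i <;> rfl
  rw [e]; exact this

lemma frontier_interior_triangle_subset {c d q : Plane} (h : AffineIndependent ℝ ![c, d, q]) :
    frontier (interior (convexHull ℝ ({c, d, q} : Set Plane))) ⊆
      segment ℝ c d ∪ segment ℝ d q ∪ segment ℝ q c := by
  rw [frontier_interior_triangle h]
  obtain ⟨b, hb⟩ := exists_affineBasis_triangle h
  rintro x ⟨hx1, hx2⟩
  rw [convexHull_triangle hb, mem_ofPred_eq] at hx1
  rw [interior_triangle hb, mem_ofPred_eq] at hx2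
  push Not at hx2
  obtain ⟨i, hi⟩ := hx2
  have hi0 : b.coord i x = 0 := le_antisymm hi (hx1 i)
  have hs := b.sum_coord_apply_eq_one x
  have hx := b.linear_combination_coord_eq_self x
  rw [Fin.sum_univ_three] at hs hx
  rw [hb] at hx
  fin_cases i
  · refine Or.inl (Or.inr ⟨_, _, hx1 1, hx1 2, ?_, ?_⟩)
    · simp only [Fin.zero_eta, Fin.isValue] at hi0
      rw [hi0] at hs; linarith
    · simp only [Fin.zero_eta, Fin.isValue] at hi0
      simpa [hi0] using hx
  · refine Or.inr ⟨_, _, hx1 2, hx1 0, ?_, ?_⟩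
    · simp only [Fin.mk_one, Fin.isValue] at hi0
      rw [hi0] at hs; linarith
    · simp only [Fin.mk_one, Fin.isValue] at hi0
      rw [hi0] at hx; simpa [add_comm] using hx
  · exact Or.inl (Or.inl (mem_segment_of_coord_eq_zero hb (hx1 0) (hx1 1) hi0))

lemma coord_of_mem_segment {c d q : Plane} {b : AffineBasis (Fin 3) ℝ Plane}
    (hb : ⇑b = ![c, d, q]) {x : Plane} (hx : x ∈ segment ℝ c d) : b.coord 2 x = 0 := by
  rw [segment_eq_lineMap_image] at hx
  obtain ⟨r, -, rfl⟩ := hx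
  have hc : b.coord 2 c = 0 := by
    have := b.coord_apply_ne (by decide : (2 : Fin 3) ≠ 0); rwa [hb] at this
  have hd : b.coord 2 d = 0 := by
    have := b.coord_apply_ne (by decide : (2 : Fin 3) ≠ 1); rwa [hb] at this
  rw [coord_lineMap, hc, hd]; ring

lemma segment_subset_frontier {c d q : Plane} (h : AffineIndependent ℝ ![c, d, q]) :
    segment ℝ c d ⊆ frontier (interior (convexHull ℝ ({c, d, q} : Set Plane))) := by
  obtain ⟨b, hb⟩ := exists_affineBasis_triangle h
  intro x hx
  rw [frontier_interior_triangle h, interior_triangle hb]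
  refine ⟨segment_subset_convexHull (by simp) (by simp) hx, fun hx' => ?_⟩
  exact (hx' 2).ne' (coord_of_mem_segment hb hx)

/-- Two triangles that share a side and meet only there lie on opposite sides of it. -/
lemma exists_neg_coord_eq_mul {c d q q' : Plane} {b b' : AffineBasis (Fin 3) ℝ Plane}
    (hb : ⇑b = ![c, d, q]) (hb' : ⇑b' = ![c, d, q'])
    (hint : convexHull ℝ {c, d, q} ∩ convexHull ℝ {c, d, q'} ⊆ segment ℝ c d) :
    ∃ l < (0 : ℝ), ∀ x, b'.coord 2 x = l * b.coord 2 x := by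
  have hc : ∀ (i : Fin 3), b'.coord i c = if i = 0 then 1 else 0 := by
    intro i; have := b'.coord_apply i 0; rwa [hb'] at this
  have hd : ∀ (i : Fin 3), b'.coord i d = if i = 1 then 1 else 0 := by
    intro i; have := b'.coord_apply i 1; rwa [hb'] at this
  have hcb : ∀ (i : Fin 3), b.coord i c = if i = 0 then 1 else 0 := by
    intro i; have := b.coord_apply i 0; rwa [hb] at this
  have hdb : ∀ (i : Fin 3), b.coord i d = if i = 1 then 1 else 0 := by
    intro i; have := b.coord_apply i 1; rwa [hb] at this
  have hqb : ∀ (i : Fin 3), b.coord i q = if i = 2 then 1 else 0 := by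
    intro i; have := b.coord_apply i 2; rwa [hb] at this
  -- Both third coordinates are affine and vanish at `c` and `d`, so they are proportional;
  -- evaluation at `q` gives the factor.
  have hprop : ∀ x, b'.coord 2 x = b'.coord 2 q * b.coord 2 x := by
    intro x
    have hx := b.affineCombination_coord_eq_self x
    have := congrArg (b'.coord 2) hx
    rw [Finset.map_affineCombination _ _ _ (b.sum_coord_apply_eq_one x),
      Finset.affineCombination_eq_linear_combination _ _ _ (b.sum_coord_apply_eq_one x),
      Fin.sum_univ_three, hb] at this
    simp [hc, hd] at this
    rw [← this, mul_comm]
  refine ⟨b'.coord 2 q, ?_, hprop⟩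
  by_contra! hl
  have hl0 : b'.coord 2 q ≠ 0 := by
    intro h0
    -- A zero factor would contradict that the third coordinate for `b'` is `1` at `q'`.
    have := hprop q'
    rw [h0, zero_mul] at this
    have h1 := b'.coord_apply_eq 2
    rw [hb'] at h1
    simp at h1
    rw [h1] at this
    exact one_ne_zero this
  have hlpos : 0 < b'.coord 2 q := lt_of_le_of_ne hl hl0.symm
  set m : Plane := AffineMap.lineMap c d (1 / 2 : ℝ) with hm
  have hev : ∀ i : Fin 3, i ≠ 2 →
      ∀ᶠ r : ℝ in 𝓝[>] 0, 0 < b'.coord i (AffineMap.lineMap m q r) := by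
    intro i hi
    have hcont : Continuous fun r : ℝ => b'.coord i (AffineMap.lineMap m q r) := by
      simp only [coord_lineMap]; fun_prop
    refine (hcont.continuousAt.eventually_mem (s := Ioi 0) (Ioi_mem_nhds ?_)).filter_mono
      nhdsWithin_le_nhds
    rw [coord_lineMap, hm, coord_lineMap, hc, hd]
    fin_cases i
    · norm_num
    · norm_num
    · exact absurd rfl hi
  obtain ⟨r, ⟨⟨hr0, hr1⟩, hr⟩⟩ := (((hev 0 (by decide)).and (hev 1 (by decide))).and
    (Ioo_mem_nhdsGT one_pos)).exists
  have hmem : AffineMap.lineMap m q r ∈ segment ℝ c d := by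
    apply hint
    rw [convexHull_triangle hb, convexHull_triangle hb']
    constructor
    · intro i
      rw [coord_lineMap, hm, coord_lineMap, hcb, hdb, hqb]
      have := hr.1; have := hr.2
      fin_cases i <;> simp <;> linarith
    · intro i
      fin_cases i
      · exact hr0.le
      · exact hr1.le
      · change 0 ≤ b'.coord 2 _
        rw [coord_lineMap, hm, coord_lineMap, hc, hd]
        simp
        exact mul_nonneg hr.1.le hlpos.le
  have := coord_of_mem_segment hb hmem
  rw [coord_lineMap, hm, coord_lineMap, hcb, hdb, hqb] at this
  simp at this
  exact hr.1.ne' this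

/-- A relatively interior point of the common side of two triangles on opposite sides of it is an
interior point of their union. -/
lemma mem_interior_union {c d q q' : Plane} {b b' : AffineBasis (Fin 3) ℝ Plane}
    (hb : ⇑b = ![c, d, q]) (hb' : ⇑b' = ![c, d, q']) {l : ℝ} (hl : l < 0)
    (hprop : ∀ x, b'.coord 2 x = l * b.coord 2 x) {x : Plane} (hx : x ∈ segment ℝ c d)
    (hxc : x ≠ c) (hxd : x ≠ d) :
    x ∈ interior (convexHull ℝ {c, d, q} ∪ convexHull ℝ {c, d, q'}) := by
  rw [segment_eq_lineMap_image] at hx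
  obtain ⟨r, hr, rfl⟩ := hx
  have hr0 : 0 < r := lt_of_le_of_ne hr.1 (by rintro rfl; simp at hxc)
  have hr1 : r < 1 := lt_of_le_of_ne hr.2 (by rintro rfl; simp at hxd)
  have aux : ∀ (b : AffineBasis (Fin 3) ℝ Plane) (q : Plane), ⇑b = ![c, d, q] → ∀ i : Fin 3,
      i ≠ 2 → ∀ᶠ y in 𝓝 (AffineMap.lineMap c d r : Plane), 0 < b.coord i y := by
    intro b q hb i hi
    have hcont : Continuous (b.coord i) := continuous_barycentric_coord b i
    refine hcont.continuousAt.eventually_mem (s := Ioi 0) (Ioi_mem_nhds ?_)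
    have hc := b.coord_apply i 0
    have hd := b.coord_apply i 1
    rw [hb] at hc hd
    change b.coord i c = _ at hc
    change b.coord i d = _ at hd
    rw [coord_lineMap, hc, hd]
    fin_cases i <;> simp at hi ⊢ <;> linarith
  -- Near `x` the first two coordinates stay positive for both triangles, so the sign of the third
  -- decides which of the two contains the point.
  rw [mem_interior_iff_mem_nhds]
  filter_upwards [aux b q hb 0 (by decide), aux b q hb 1 (by decide), aux b' q' hb' 0 (by decide),
    aux b' q' hb' 1 (by decide)] with y h1 h2 h3 h4
  rw [convexHull_triangle hb, convexHull_triangle hb']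
  rcases le_total 0 (b.coord 2 y) with h5 | h5
  · left
    intro i
    fin_cases i
    exacts [h1.le, h2.le, h5]
  · right
    intro i
    fin_cases i
    · exact h3.le
    · exact h4.le
    · change 0 ≤ b'.coord 2 y
      rw [hprop]
      exact mul_nonneg_of_nonpos_of_nonpos hl.le h5

/-! ### The triangles and edges of a triangulation -/

lemma exists_third_vertex {s : Finset Plane} (h : AffineIndependent ℝ ((↑) : s → Plane))
    (hcard : s.card = 3) {c d : Plane} (hc : c ∈ s) (hd : d ∈ s) (hcd : c ≠ d) :
    ∃ q, (s : Set Plane) = {c, d, q} ∧ AffineIndependent ℝ ![c, d, q] := by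
  classical
  have hsub : ({c, d} : Finset Plane) ⊆ s := by
    intro x hx; simp at hx; rcases hx with rfl | rfl <;> assumption
  have h1 : (s \ {c, d}).card = 1 := by
    rw [Finset.card_sdiff_of_subset hsub, hcard, Finset.card_pair hcd]
  obtain ⟨q, hq⟩ := Finset.card_eq_one.1 h1
  have hqs : q ∈ s \ {c, d} := by rw [hq]; simp
  simp only [Finset.mem_sdiff, Finset.mem_insert, Finset.mem_singleton, not_or] at hqs
  refine ⟨q, ?_, ?_⟩
  · rw [← Finset.union_sdiff_of_subset hsub, hq]
    ext x; simp
  · let g : Fin 3 ↪ s := ⟨![⟨c, hc⟩, ⟨d, hd⟩, ⟨q, hqs.1⟩], by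
      intro i j hij
      have h1 := hqs.2.1; have h2 := hqs.2.2
      fin_cases i <;> fin_cases j <;> simp_all [eq_comm]⟩
    have := h.comp_embedding g
    have e : ![c, d, q] = (((↑) : s → Plane) ∘ g) := by
      ext i j
      fin_cases i <;> rfl
    rw [e]; exact this

lemma exists_vertices {s : Finset Plane} (h : AffineIndependent ℝ ((↑) : s → Plane))
    (hcard : s.card = 3) :
    ∃ c d q, (s : Set Plane) = {c, d, q} ∧ AffineIndependent ℝ ![c, d, q] := by
  obtain ⟨c, hc, d, hd, hcd⟩ := Finset.one_lt_card.1 (by omega : 1 < s.card)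
  exact ⟨c, d, exists_third_vertex h hcard hc hd hcd⟩

/-- The diameter is at most twice the circumscribed radius, hence at most `2κ` times the inscribed
radius. The triangle contains a ball whose radius `r` exceeds half of the inscribed radius, which
avoids asking whether the supremum is attained. So the diameter is at most `4 κ r`, while the area
is at least `π r² ≥ r²`. -/
lemma diam_sq_le_volume {s : Finset Plane} (h : AffineIndependent ℝ ((↑) : s → Plane))
    (hcard : s.card = 3) {κ : ℝ} (hκ : circumscribedRadius s / inscribedRadius s ≤ κ) :
    ENNReal.ofReal (Metric.diam (convexHull ℝ (s : Set Plane)) ^ 2) ≤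
      ENNReal.ofReal (16 * κ ^ 2) * volume (convexHull ℝ (s : Set Plane)) := by
  obtain ⟨c, d, q, hs, hind⟩ := exists_vertices h hcard
  set K := convexHull ℝ (s : Set Plane) with hK
  have hKb : Bornology.IsBounded K := (s.finite_toSet.isCompact_convexHull (𝕜 := ℝ)).isBounded
  have hbdd : BddAbove {r : ℝ | 0 ≤ r ∧ ∃ c : Plane, Metric.closedBall c r ⊆ K} := by
    refine ⟨Metric.diam K, ?_⟩
    rintro r ⟨hr, c, hc⟩
    have h1 := Metric.diam_mono hc hKb
    rw [Metric.diam_closedBall_eq _ hr] at h1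
    linarith
  have hpos : 0 < inscribedRadius s := by
    obtain ⟨x, hx⟩ := interior_triangle_nonempty hind
    rw [← hs, mem_interior_iff_mem_nhds, Metric.nhds_basis_closedBall.mem_iff] at hx
    obtain ⟨r, hr, hx⟩ := hx
    exact lt_of_lt_of_le hr (le_csSup hbdd ⟨hr.le, x, hx⟩)
  have hdiam : Metric.diam K / 2 ≤ circumscribedRadius s := by
    apply le_csInf
    · obtain ⟨R, hR⟩ := hKb.subset_closedBall 0
      exact ⟨max R 0, le_max_right _ _, 0,
        hR.trans (Metric.closedBall_subset_closedBall (le_max_left _ _))⟩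
    · rintro R ⟨hR, c, hc⟩
      have h1 := Metric.diam_mono hc Metric.isBounded_closedBall
      have h2 := Metric.diam_closedBall (x := c) hR
      linarith
  have hκ0 : 0 ≤ κ := by
    refine le_trans (div_nonneg ?_ hpos.le) hκ
    linarith [Metric.diam_nonneg (s := K)]
  rw [div_le_iff₀ hpos] at hκ
  have hne : {r : ℝ | 0 ≤ r ∧ ∃ c : Plane, Metric.closedBall c r ⊆ K}.Nonempty := by
    obtain ⟨x, hx⟩ := interior_triangle_nonempty hind
    rw [← hs] at hx
    exact ⟨0, le_rfl, x, by simpa using interior_subset hx⟩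
  obtain ⟨r, ⟨hr0, c, hc⟩, hr⟩ := exists_lt_of_lt_csSup hne (half_lt_self hpos)
  change inscribedRadius s / 2 < r at hr
  have h4 : Metric.diam K ≤ 4 * κ * r := by nlinarith
  have hvol : ENNReal.ofReal (r ^ 2) ≤ volume K := by
    refine le_trans ?_ (measure_mono hc)
    rw [EuclideanSpace.volume_closedBall_fin_two, ENNReal.ofReal_pow hr0]
    refine le_mul_of_one_le_right' ?_
    rw [ENNReal.one_le_ofReal]
    linarith [Real.pi_gt_three]
  refine le_trans ?_ (mul_le_mul_right hvol _)
  rw [← ENNReal.ofReal_mul (by positivity)]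
  apply ENNReal.ofReal_le_ofReal
  have := Metric.diam_nonneg (s := K)
  nlinarith

namespace Triangulation

variable {Ω : Set Plane} (T : Triangulation Ω)

lemma mem_elements {s : Finset Plane} : s ∈ T.elements ↔ s ∈ T.complex.faces ∧ s.card = 3 := by
  simp [elements]

lemma mem_elementsAt {e s : Finset Plane} : s ∈ T.elementsAt e ↔ s ∈ T.elements ∧ e ⊆ s := by
  simp [elementsAt]

lemma affineIndependent {s : Finset Plane} (hs : s ∈ T.elements) :
    AffineIndependent ℝ ((↑) : s → Plane) := T.complex.indep (T.mem_elements.1 hs).1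

lemma closure_eq : closure Ω = ⋃ s ∈ T.elements, convexHull ℝ (s : Set Plane) := by
  rw [← T.space_eq]
  ext x
  rw [Geometry.SimplicialComplex.mem_space_iff]
  simp only [mem_iUnion]
  constructor
  · rintro ⟨s, hs, hx⟩
    obtain ⟨t, ht, hst, htc⟩ := T.face_of_triangle s hs
    exact ⟨t, T.mem_elements.2 ⟨ht, htc⟩, convexHull_mono (by exact_mod_cast hst) hx⟩
  · rintro ⟨s, hs, hx⟩
    exact ⟨s, (T.mem_elements.1 hs).1, hx⟩

lemma convexHull_subset_closure {s : Finset Plane} (hs : s ∈ T.elements) :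
    convexHull ℝ (s : Set Plane) ⊆ closure Ω := by
  rw [T.closure_eq]; exact subset_biUnion_of_mem (u := fun s : Finset Plane =>
    convexHull ℝ (s : Set Plane)) hs

lemma convexHull_inter_subset {k l : Finset Plane} (hk : k ∈ T.elements) (hl : l ∈ T.elements) :
    convexHull ℝ (k : Set Plane) ∩ convexHull ℝ (l : Set Plane) ⊆
      convexHull ℝ ((k : Set Plane) ∩ l) :=
  T.complex.inter_subset_convexHull (T.mem_elements.1 hk).1 (T.mem_elements.1 hl).1

lemma inter_subset_segment {k l : Finset Plane} (hk : k ∈ T.elements) (hl : l ∈ T.elements)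
    (hkl : k ≠ l) {c d q q' : Plane} (hkq : (k : Set Plane) = {c, d, q})
    (hlq : (l : Set Plane) = {c, d, q'}) :
    convexHull ℝ {c, d, q} ∩ convexHull ℝ {c, d, q'} ⊆ segment ℝ c d := by
  have h := T.convexHull_inter_subset hk hl
  rw [hkq, hlq] at h
  refine h.trans ?_
  rw [← convexHull_pair]
  apply convexHull_mono
  rintro x ⟨hx1, hx2⟩
  simp only [mem_insert_iff, mem_singleton_iff] at hx1 hx2 ⊢
  rcases hx1 with h1 | h1 | h1
  · exact Or.inl h1
  · exact Or.inr h1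
  · rcases hx2 with h2 | h2 | h2
    · exact Or.inl h2
    · exact Or.inr h2
    · exact absurd (Finset.coe_injective (by rw [hkq, hlq, ← h1, h2])) hkl

/-- Of three elements at one edge, any two would lie on opposite sides of it; but two changes of
side lead back to the first side. -/
lemma card_elementsAt_le {e : Finset Plane} (he : e.card = 2) : (T.elementsAt e).card ≤ 2 := by
  by_contra! hcon
  obtain ⟨k, hk, l, hl, m, hm, hkl, hkm, hlm⟩ := Finset.two_lt_card.1 hcon
  rw [mem_elementsAt] at hk hl hm
  obtain ⟨c, d, hcd, rfl⟩ := Finset.card_eq_two.1 he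
  have third : ∀ s ∈ T.elements, {c, d} ⊆ s → ∃ q, ∃ b : AffineBasis (Fin 3) ℝ Plane,
      (s : Set Plane) = {c, d, q} ∧ ⇑b = ![c, d, q] := by
    intro s hs hes
    obtain ⟨q, hq, hind⟩ := exists_third_vertex (T.affineIndependent hs) (T.mem_elements.1 hs).2
      (hes (by simp)) (hes (by simp)) hcd
    obtain ⟨b, hb⟩ := exists_affineBasis_triangle hind
    exact ⟨q, b, hq, hb⟩
  obtain ⟨q₁, b₁, hq₁, hb₁⟩ := third k hk.1 hk.2
  obtain ⟨q₂, b₂, hq₂, hb₂⟩ := third l hl.1 hl.2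
  obtain ⟨q₃, b₃, hq₃, hb₃⟩ := third m hm.1 hm.2
  obtain ⟨x, hx, hx'⟩ := exists_neg_coord_eq_mul hb₁ hb₂ (T.inter_subset_segment hk.1 hl.1 hkl hq₁ hq₂)
  obtain ⟨y, hy, hy'⟩ := exists_neg_coord_eq_mul hb₂ hb₃ (T.inter_subset_segment hl.1 hm.1 hlm hq₂ hq₃)
  obtain ⟨z, hz, hz'⟩ := exists_neg_coord_eq_mul hb₁ hb₃ (T.inter_subset_segment hk.1 hm.1 hkm hq₁ hq₃)
  have h1 : b₁.coord 2 q₁ = 1 := by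
    have := b₁.coord_apply_eq 2; rwa [hb₁] at this
  have h2 := hz' q₁
  rw [hy', hx', h1] at h2
  nlinarith [mul_pos_of_neg_of_neg hx hy]

open Classical in
lemma inter_mem_interiorEdges {k l : Finset Plane} (hk : k ∈ T.elements) (hl : l ∈ T.elements)
    (hkl : k ≠ l) (hcard : (k ∩ l).card = 2) : k ∩ l ∈ T.interiorEdges := by
  have hface : k ∩ l ∈ T.complex.faces := T.complex.down_closed (T.mem_elements.1 hk).1
    Finset.inter_subset_left (Finset.card_pos.1 (by omega))
  have h2 : 1 < (T.elementsAt (k ∩ l)).card := Finset.one_lt_card.2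
    ⟨k, T.mem_elementsAt.2 ⟨hk, Finset.inter_subset_left⟩, l,
      T.mem_elementsAt.2 ⟨hl, Finset.inter_subset_right⟩, hkl⟩
  have h3 := T.card_elementsAt_le hcard
  simp only [interiorEdges, edges, Finset.mem_filter, Finite.mem_toFinset]
  exact ⟨⟨hface, hcard⟩, by omega⟩

open Classical in
lemma card_inter_le {k l : Finset Plane} (hk : k ∈ T.elements) (hl : l ∈ T.elements)
    (hkl : k ≠ l) : (k ∩ l).card ≤ 2 := by
  by_contra! h
  have hk3 := (T.mem_elements.1 hk).2
  have hl3 := (T.mem_elements.1 hl).2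
  have h1 := Finset.eq_of_subset_of_card_le (Finset.inter_subset_left : k ∩ l ⊆ k) (by omega)
  have h2 := Finset.eq_of_subset_of_card_le (Finset.inter_subset_right : k ∩ l ⊆ l) (by omega)
  exact hkl (h1.symm.trans h2)

/-- The vertices of the triangulation. -/
def vertexSet : Set Plane := ⋃ s ∈ T.elements, (s : Set Plane)

lemma finite_vertexSet : T.vertexSet.Finite :=
  T.elements.finite_toSet.biUnion fun s _ => s.finite_toSet

/-- Two elements meet in a vertex or in an edge. -/
lemma mem_vertexSet_or_card_inter {k l : Finset Plane} (hk : k ∈ T.elements) (hl : l ∈ T.elements)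
    (hkl : k ≠ l) {x : Plane} (hxk : x ∈ convexHull ℝ (k : Set Plane))
    (hxl : x ∈ convexHull ℝ (l : Set Plane)) (hx : x ∉ T.vertexSet) :
    ∃ c d, c ≠ d ∧ c ∈ k ∧ c ∈ l ∧ d ∈ k ∧ d ∈ l ∧ x ∈ segment ℝ c d ∧
      ∃ e ∈ T.interiorEdges, (e : Set Plane) = {c, d} := by
  classical
  have h := T.convexHull_inter_subset hk hl ⟨hxk, hxl⟩
  rw [← Finset.coe_inter] at h
  have hle := T.card_inter_le hk hl hkl
  interval_cases hc : (k ∩ l).card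
  · rw [Finset.card_eq_zero.1 hc] at h; simp at h
  · obtain ⟨v, hv⟩ := Finset.card_eq_one.1 hc
    rw [hv] at h
    simp only [Finset.coe_singleton, convexHull_singleton, mem_singleton_iff] at h
    have hvk : v ∈ k ∩ l := by rw [hv]; simp
    refine absurd ?_ hx
    rw [h]
    exact mem_biUnion hk (Finset.mem_inter.1 hvk).1
  · have he := T.inter_mem_interiorEdges hk hl hkl hc
    obtain ⟨c, d, hcd, hv⟩ := Finset.card_eq_two.1 hc
    have hck : c ∈ k ∩ l := by rw [hv]; simp
    have hdk : d ∈ k ∩ l := by rw [hv]; simp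
    rw [Finset.mem_inter] at hck hdk
    rw [hv, Finset.coe_pair, convexHull_pair] at h
    exact ⟨c, d, hcd, hck.1, hck.2, hdk.1, hdk.2, h, _, he, by rw [hv]; simp⟩

/-- This is how the absence of slits is used: whatever is interior to a union of closed elements is
interior to `Ω`, so it is not on the boundary. -/
lemma frontier_inter_interior {Ω : Set Plane} (hΩ : interior (closure Ω) = Ω) {A : Set Plane}
    (hA : A ⊆ closure Ω) : Disjoint (frontier Ω) (interior A) := by
  have h1 : interior A ⊆ Ω := by rw [← hΩ]; exact interior_mono hA
  have h2 : IsOpen Ω := by rw [← hΩ]; exact isOpen_interior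
  exact (disjoint_frontier_iff_isOpen.2 h2).mono_right h1

/-- A boundary point that is not a vertex is in one element only. -/
lemma eq_of_mem_frontier (hΩ : interior (closure Ω) = Ω) {k l : Finset Plane}
    (hk : k ∈ T.elements) (hl : l ∈ T.elements) {x : Plane} (hx : x ∈ frontier Ω)
    (hxv : x ∉ T.vertexSet) (hxk : x ∈ convexHull ℝ (k : Set Plane))
    (hxl : x ∈ convexHull ℝ (l : Set Plane)) : k = l := by
  by_contra hkl
  obtain ⟨c, d, hcd, hck, hcl, hdk, hdl, hseg, -⟩ :=
    T.mem_vertexSet_or_card_inter hk hl hkl hxk hxl hxv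
  obtain ⟨q, hq, hind⟩ := exists_third_vertex (T.affineIndependent hk) (T.mem_elements.1 hk).2
    hck hdk hcd
  obtain ⟨q', hq', hind'⟩ := exists_third_vertex (T.affineIndependent hl) (T.mem_elements.1 hl).2
    hcl hdl hcd
  obtain ⟨b, hb⟩ := exists_affineBasis_triangle hind
  obtain ⟨b', hb'⟩ := exists_affineBasis_triangle hind'
  obtain ⟨r, hr, hr'⟩ := exists_neg_coord_eq_mul hb hb' (T.inter_subset_segment hk hl hkl hq hq')
  -- Two elements sharing the point would share an edge through it and together fill a neighbourhood
  -- of it, which is impossible at a boundary point.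
  have hint := mem_interior_union hb hb' hr hr' hseg
    (by rintro rfl; exact hxv (mem_biUnion hk hck)) (by rintro rfl; exact hxv (mem_biUnion hk hdk))
  rw [← hq, ← hq'] at hint
  exact (frontier_inter_interior hΩ (union_subset (T.convexHull_subset_closure hk)
    (T.convexHull_subset_closure hl))).le_bot ⟨hx, hint⟩

lemma isCompact_convexHull (s : Finset Plane) : IsCompact (convexHull ℝ (s : Set Plane)) :=
  s.finite_toSet.isCompact_convexHull (𝕜 := ℝ)

lemma measurableSet_convexHull (s : Finset Plane) :
    MeasurableSet (convexHull ℝ (s : Set Plane)) := (isCompact_convexHull s).isClosed.measurableSet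

/-- The intersection of two closed elements is in the convex hull of at most two points, which has
empty interior in the plane. -/
lemma disjoint_openTriangle {k l : Finset Plane} (hk : k ∈ T.elements) (hl : l ∈ T.elements)
    (hkl : k ≠ l) : Disjoint (openTriangle k) (openTriangle l) := by
  classical
  rw [Set.disjoint_iff_inter_eq_empty, openTriangle, openTriangle, ← interior_inter]
  by_contra hne
  rw [← Ne, ← Set.nonempty_iff_ne_empty] at hne
  have h := hne.mono (interior_mono (T.convexHull_inter_subset hk hl))
  rw [interior_convexHull_nonempty_iff_affineSpan_eq_top, ← Finset.coe_inter] at h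
  have hind : AffineIndependent ℝ ((↑) : (k ∩ l : Finset Plane) → Plane) :=
    (T.affineIndependent hk).mono (by simp)
  have h1 := hind.affineSpan_eq_top_iff_card_eq_finrank_add_one
  rw [Subtype.range_coe_subtype] at h1
  have h2 := h1.1 h
  rw [Fintype.card_coe, finrank_euclideanSpace_fin] at h2
  have := T.card_inter_le hk hl hkl
  omega

end Triangulation

lemma measurable_lintegral_rays (c v z : Plane) {K : Set Plane} (hK : MeasurableSet K)
    {g : Plane → ℝ≥0∞} (hg : Measurable g) :
    Measurable fun s : ℝ => ∫⁻ t in {t | t ∈ Icc (0:ℝ) (1 / 2) ∧ affineCoords c v z (s, t) ∈ K},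
        g (affineCoords c v z (s, t)) := by
  have hm : Measurable (affineCoords c v z) := (continuous_affineCoords c v z).measurable
  have hS : MeasurableSet {p : ℝ × ℝ | p.2 ∈ Icc (0:ℝ) (1 / 2) ∧ affineCoords c v z p ∈ K} :=
    (measurable_snd measurableSet_Icc).inter (hm hK)
  have h1 := ((hg.comp hm).indicator hS).lintegral_prod_right' (ν := (volume : Measure ℝ))
  convert h1 using 2 with s
  have hS' : MeasurableSet {t | t ∈ Icc (0:ℝ) (1 / 2) ∧ affineCoords c v z (s, t) ∈ K} :=
    measurable_prodMk_left hS
  rw [← lintegral_indicator hS']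
  rfl

/-! ### Energies of piecewise smooth functions and the jumps of their squares. -/

namespace Triangulation

variable {Ω : Set Plane} (T : Triangulation Ω)

/-- Twice the squares of the `L²` norms of the jumps, with the weights of the edges. -/
def jumpEnergy (w : Finset Plane → Plane → ℝ) : ℝ≥0∞ :=
  ∑ e ∈ T.interiorEdges, (ENNReal.ofReal (Metric.diam (e : Set Plane)))⁻¹ *
    ∑ k ∈ T.elementsAt e, ∑ l ∈ T.elementsAt e,
      ∫⁻ x in convexHull ℝ (e : Set Plane), ‖w k x - w l x‖ₑ ^ 2 ∂arcLength

/-- The sum of the squares of the `H¹` norms on the elements. -/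
def elementEnergy (w : Finset Plane → Plane → ℝ) : ℝ≥0∞ :=
  ∑ s ∈ T.elements, ∫⁻ x in convexHull ℝ (s : Set Plane), energyDensity (w s) x

lemma card_of_mem_interiorEdges {e : Finset Plane} (he : e ∈ T.interiorEdges) : e.card = 2 := by
  simp only [interiorEdges, edges, Finset.mem_filter] at he
  exact he.1.2

lemma card_elementsAt {e : Finset Plane} (he : e ∈ T.interiorEdges) :
    (T.elementsAt e).card = 2 := by
  simp only [interiorEdges, Finset.mem_filter] at he
  exact he.2

lemma dist_le_diam {s : Finset Plane} {x y : Plane} (hx : x ∈ s) (hy : y ∈ s) :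
    dist x y ≤ Metric.diam (convexHull ℝ (s : Set Plane)) :=
  Metric.dist_le_diam_of_mem (isCompact_convexHull s).isBounded (subset_convexHull ℝ _ hx)
    (subset_convexHull ℝ _ hy)

lemma diam_convexHull_le (hΩ : Bornology.IsBounded Ω) {s : Finset Plane} (hs : s ∈ T.elements) :
    Metric.diam (convexHull ℝ (s : Set Plane)) ≤ Metric.diam (closure Ω) :=
  Metric.diam_mono (T.convexHull_subset_closure hs) hΩ.closure

lemma ratio_le {κ : ℝ} (hκ : T.shapeRegularity ≤ κ) {s : Finset Plane} (hs : s ∈ T.elements) :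
    circumscribedRadius s / inscribedRadius s ≤ κ :=
  (le_csSup (T.elements.finite_toSet.image _).bddAbove (mem_image_of_mem _ hs)).trans hκ

lemma volume_ne_top (s : Finset Plane) : volume (convexHull ℝ (s : Set Plane)) ≠ ⊤ :=
  (isCompact_convexHull s).measure_lt_top.ne

lemma volume_ne_zero {s : Finset Plane} (hs : s ∈ T.elements) :
    volume (convexHull ℝ (s : Set Plane)) ≠ 0 := by
  obtain ⟨c, d, q, hq, hind⟩ := exists_vertices (T.affineIndependent hs) (T.mem_elements.1 hs).2
  rw [hq]
  exact (Measure.measure_pos_of_nonempty_interior _ (interior_triangle_nonempty hind)).ne'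

/-- The local trace inequality, scaled by the length of the edge. -/
lemma diam_mul_lintegral_edge_le (hΩ : Bornology.IsBounded Ω) {κ : ℝ}
    (hκ : T.shapeRegularity ≤ κ) {e k : Finset Plane} (he : e.card = 2)
    (hk : k ∈ T.elementsAt e) {w : Plane → ℝ} (hw : ContDiff ℝ 1 w) :
    ENNReal.ofReal (Metric.diam (e : Set Plane)) *
      ∫⁻ x in convexHull ℝ (e : Set Plane), ‖w x‖ₑ ^ 2 ∂arcLength ≤
      (2 * ENNReal.ofReal (16 * κ ^ 2) * ENNReal.ofReal (3 + Metric.diam (closure Ω) ^ 2)) *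
        ∫⁻ x in convexHull ℝ (k : Set Plane), energyDensity w x := by
  rw [mem_elementsAt] at hk
  obtain ⟨hk, hek⟩ := hk
  obtain ⟨c, d, hcd, rfl⟩ := Finset.card_eq_two.1 he
  obtain ⟨q, hq, hind⟩ := exists_third_vertex (T.affineIndependent hk) (T.mem_elements.1 hk).2
      (hek (by simp)) (hek (by simp)) hcd
  have hqk : q ∈ k := by
    have : q ∈ (k : Set Plane) := by rw [hq]; simp
    exact_mod_cast this
  have hck : c ∈ k := hek (by simp)
  have hdk : d ∈ k := hek (by simp)
  have hδ := T.diam_convexHull_le hΩ hk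
  have h1 := lintegral_side_le hind hw ((dist_le_diam hck hqk).trans hδ)
    ((dist_le_diam hdk hqk).trans hδ)
  rw [← hq] at h1
  rw [Finset.coe_pair, convexHull_pair, Metric.diam_pair]
  set V := volume (convexHull ℝ (k : Set Plane)) with hV
  -- One factor is the weight of the edge, the other the speed of the parametrization of the side;
  -- their product is comparable to the area by shape regularity.
  have h2 : ENNReal.ofReal (dist c d) * ENNReal.ofReal (dist c d) * V⁻¹ ≤
      ENNReal.ofReal (16 * κ ^ 2) := by
    rw [← div_eq_mul_inv, ENNReal.div_le_iff (T.volume_ne_zero hk) (volume_ne_top k)]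
    refine le_trans ?_ (diam_sq_le_volume (T.affineIndependent hk) (T.mem_elements.1 hk).2
      (T.ratio_le hκ hk))
    rw [← ENNReal.ofReal_mul dist_nonneg]
    apply ENNReal.ofReal_le_ofReal
    have := dist_le_diam hck hdk
    nlinarith [dist_nonneg (x := c) (y := d)]
  calc _ ≤ ENNReal.ofReal (dist c d) * _ := mul_le_mul_right h1 _
    _ = 2 * (ENNReal.ofReal (dist c d) * ENNReal.ofReal (dist c d) * V⁻¹) *
        ENNReal.ofReal (3 + Metric.diam (closure Ω) ^ 2) *
          ∫⁻ x in convexHull ℝ (k : Set Plane), energyDensity w x := by ring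
    _ ≤ _ := by gcongr

/-- Young's inequality for `(p - q) (p + q)` with weight `δ`. With `δ` the length of an edge, the
first term is the integrand of the jump term in the norm, and the second has the weight that the
local trace inequality can absorb. -/
lemma enorm_sq_sub_sq_le (p q : ℝ) {δ : ℝ} (hδ : 0 < δ) :
    ‖p ^ 2 - q ^ 2‖ₑ ≤ (ENNReal.ofReal δ)⁻¹ * ‖p - q‖ₑ ^ 2 +
      2 * ENNReal.ofReal δ * (‖p‖ₑ ^ 2 + ‖q‖ₑ ^ 2) := by
  have h : |p ^ 2 - q ^ 2| ≤ δ⁻¹ * |p - q| ^ 2 + 2 * δ * (|p| ^ 2 + |q| ^ 2) := by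
    have e : p ^ 2 - q ^ 2 = (p - q) * (p + q) := by ring
    rw [e, abs_mul, sq_abs p, sq_abs q]
    have h1 : 2 * (|p - q| * |p + q|) ≤ δ⁻¹ * |p - q| ^ 2 + δ * |p + q| ^ 2 := by
      have h2 := sq_nonneg (|p - q| - δ * |p + q|)
      have h3 : δ⁻¹ * |p - q| ^ 2 + δ * |p + q| ^ 2 - 2 * (|p - q| * |p + q|) =
          δ⁻¹ * (|p - q| - δ * |p + q|) ^ 2 := by field_simp; ring
      have h4 : 0 ≤ δ⁻¹ * (|p - q| - δ * |p + q|) ^ 2 := by positivity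
      linarith
    have h5 : |p + q| ^ 2 ≤ 2 * (p ^ 2 + q ^ 2) := by
      rw [sq_abs]; nlinarith [sq_nonneg (p - q)]
    have h6 : 0 ≤ δ⁻¹ * |p - q| ^ 2 := by positivity
    have h7 : 0 ≤ |p - q| * |p + q| := by positivity
    nlinarith
  simp only [Real.enorm_eq_ofReal_abs]
  rw [← ENNReal.ofReal_inv_of_pos hδ, ← ENNReal.ofReal_pow (abs_nonneg _),
    ← ENNReal.ofReal_pow (abs_nonneg _), ← ENNReal.ofReal_pow (abs_nonneg _),
    ← ENNReal.ofReal_mul (by positivity), ← ENNReal.ofReal_add (by positivity) (by positivity),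
    ← ENNReal.ofReal_ofNat 2, ← ENNReal.ofReal_mul (by positivity),
    ← ENNReal.ofReal_mul (by positivity), ← ENNReal.ofReal_add (by positivity) (by positivity)]
  exact ENNReal.ofReal_le_ofReal h

/-- The jumps of the squares across the interior edges. -/
lemma sum_lintegral_jump_sq_le (hΩ : Bornology.IsBounded Ω) {κ : ℝ}
    (hκ : T.shapeRegularity ≤ κ) {w : Finset Plane → Plane → ℝ} (hw : ∀ s, ContDiff ℝ 1 (w s)) :
    ∑ e ∈ T.interiorEdges, ∑ k ∈ T.elementsAt e, ∑ l ∈ T.elementsAt e,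
      ∫⁻ x in convexHull ℝ (e : Set Plane), ‖w k x ^ 2 - w l x ^ 2‖ₑ ∂arcLength ≤
      T.jumpEnergy w + 64 * (2 * ENNReal.ofReal (16 * κ ^ 2) *
        ENNReal.ofReal (3 + Metric.diam (closure Ω) ^ 2)) * T.elementEnergy w := by
  set C := 2 * ENNReal.ofReal (16 * κ ^ 2) * ENNReal.ofReal (3 + Metric.diam (closure Ω) ^ 2)
  set E : Finset Plane → ℝ≥0∞ := fun k =>
    ∫⁻ x in convexHull ℝ (k : Set Plane), energyDensity (w k) x with hE
  have hm : ∀ k, Measurable (w k) := fun k => (hw k).continuous.measurable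
  have step : ∀ e ∈ T.interiorEdges, ∀ k ∈ T.elementsAt e, ∀ l ∈ T.elementsAt e,
      ∫⁻ x in convexHull ℝ (e : Set Plane), ‖w k x ^ 2 - w l x ^ 2‖ₑ ∂arcLength ≤
      (ENNReal.ofReal (Metric.diam (e : Set Plane)))⁻¹ *
        (∫⁻ x in convexHull ℝ (e : Set Plane), ‖w k x - w l x‖ₑ ^ 2 ∂arcLength) +
      (2 * C * E k + 2 * C * E l) := by
    intro e he k hk l hl
    have he2 := T.card_of_mem_interiorEdges he
    have hδ : 0 < Metric.diam (e : Set Plane) := by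
      obtain ⟨c, d, hcd, rfl⟩ := Finset.card_eq_two.1 he2
      rw [Finset.coe_pair, Metric.diam_pair]
      exact dist_pos.2 hcd
    have mk : Measurable fun x => ‖w k x‖ₑ ^ 2 := (hm k).enorm.pow_const 2
    have ml : Measurable fun x => ‖w l x‖ₑ ^ 2 := (hm l).enorm.pow_const 2
    have mkl : Measurable fun x => ‖w k x - w l x‖ₑ ^ 2 :=
      ((hm k).sub (hm l)).enorm.pow_const 2
    have mk_add : Measurable fun x => ‖w k x‖ₑ ^ 2 + ‖w l x‖ₑ ^ 2 := mk.add ml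
    refine (lintegral_mono fun x => enorm_sq_sub_sq_le (w k x) (w l x) hδ).trans ?_
    rw [lintegral_add_left (mkl.const_mul _), lintegral_const_mul _ mkl,
      lintegral_const_mul _ mk_add, lintegral_add_left mk]
    gcongr
    have hk' := T.diam_mul_lintegral_edge_le hΩ hκ he2 hk (hw k)
    have hl' := T.diam_mul_lintegral_edge_le hΩ hκ he2 hl (hw l)
    calc _ = 2 * (ENNReal.ofReal (Metric.diam (e : Set Plane)) *
            ∫⁻ x in convexHull ℝ (e : Set Plane), ‖w k x‖ₑ ^ 2 ∂arcLength) +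
          2 * (ENNReal.ofReal (Metric.diam (e : Set Plane)) *
            ∫⁻ x in convexHull ℝ (e : Set Plane), ‖w l x‖ₑ ^ 2 ∂arcLength) := by ring
      _ ≤ 2 * (C * E k) + 2 * (C * E l) := by gcongr
      _ = _ := by ring
  calc _ ≤ ∑ e ∈ T.interiorEdges, ∑ k ∈ T.elementsAt e, ∑ l ∈ T.elementsAt e,
      ((ENNReal.ofReal (Metric.diam (e : Set Plane)))⁻¹ *
        (∫⁻ x in convexHull ℝ (e : Set Plane), ‖w k x - w l x‖ₑ ^ 2 ∂arcLength) +
      (2 * C * E k + 2 * C * E l)) := Finset.sum_le_sum fun e he => Finset.sum_le_sum fun k hk =>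
        Finset.sum_le_sum fun l hl => step e he k hk l hl
    -- An interior edge has two elements, so in the double sum each `E k` occurs four times with the
    -- coefficient `2 * C`.
    _ = T.jumpEnergy w + ∑ e ∈ T.interiorEdges, ∑ k ∈ T.elementsAt e, 8 * C * E k := by
      rw [jumpEnergy, ← Finset.sum_add_distrib]
      refine Finset.sum_congr rfl fun e he => ?_
      simp only [Finset.sum_add_distrib, Finset.sum_const, T.card_elementsAt he, Finset.mul_sum,
        nsmul_eq_mul]
      congr 1
      rw [← Finset.sum_add_distrib]
      refine Finset.sum_congr rfl fun k hk => ?_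
      push_cast
      ring
    _ ≤ _ := by
      gcongr
      rw [elementEnergy, Finset.mul_sum]
      classical
      calc ∑ e ∈ T.interiorEdges, ∑ k ∈ T.elementsAt e, 8 * C * E k
          = ∑ k ∈ T.elements, ∑ e ∈ T.interiorEdges with e ⊆ k, 8 * C * E k := by
            apply Finset.sum_comm'
            intro e k
            simp only [mem_elementsAt, Finset.mem_filter]
            tauto
        _ ≤ _ := by
            refine Finset.sum_le_sum fun k hk => ?_
            rw [Finset.sum_const, nsmul_eq_mul]
            -- A crude count: the edges of an element are among the `2 ^ 3` subsets of its vertex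
            -- set. With the coefficient `8` above this gives `64`.
            have h8 : (T.interiorEdges.filter (· ⊆ k)).card ≤ 8 := by
              have : T.interiorEdges.filter (· ⊆ k) ⊆ k.powerset := by
                intro e he
                exact Finset.mem_powerset.2 (Finset.mem_filter.1 he).2
              have := Finset.card_le_card this
              rwa [Finset.card_powerset, (T.mem_elements.1 hk).2] at this
            calc _ ≤ (8 : ℝ≥0∞) * (8 * C * E k) := by gcongr; exact_mod_cast h8
              _ = 64 * C * E k := by ring

/-- The piecewise function `w` on the closed elements. -/
def piecewise (w : Finset Plane → Plane → ℝ) (x : Plane) : ℝ :=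
  ∑ s ∈ T.elements, (convexHull ℝ (s : Set Plane)).indicator (w s) x

/-- Away from the vertices a boundary point is in exactly one closed element, so the sum defining
`piecewise` has a single surviving term. -/
lemma enorm_piecewise_le (hΩ : interior (closure Ω) = Ω) {w : Finset Plane → Plane → ℝ}
    {x : Plane} (hx : x ∈ frontier Ω) (hxv : x ∉ T.vertexSet) {B : ℝ≥0∞}
    (hB : ∀ i ∈ T.elements, x ∈ convexHull ℝ (i : Set Plane) → ‖w i x‖ₑ ^ 2 ≤ B) :
    ‖T.piecewise w x‖ₑ ^ 2 ≤ B := by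
  have hx' := frontier_subset_closure hx
  rw [T.closure_eq, mem_iUnion₂] at hx'
  obtain ⟨i, hi, hxi⟩ := hx'
  have : T.piecewise w x = w i x := by
    rw [piecewise, Finset.sum_eq_single i, indicator_of_mem hxi]
    · intro k hk hki
      apply indicator_of_notMem
      intro hxk
      exact hki (T.eq_of_mem_frontier hΩ hk hi hx hxv hxk hxi)
    · exact fun h => absurd hi h
  rw [this]
  exact hB i hi hxi

end Triangulation

/-! ### The trace inequality for piecewise smooth functions. -/

lemma exists_lipschitz_coord (b : AffineBasis (Fin 3) ℝ Plane) (i : Fin 3) :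
    ∃ L : ℝ, ∀ x y, |b.coord i x - b.coord i y| ≤ L * dist x y := by
  refine ⟨‖(b.coord i).linear.toContinuousLinearMap‖, fun x y => ?_⟩
  have := (b.coord i).linear.toContinuousLinearMap.le_opNorm (x - y)
  rw [dist_eq_norm]
  refine le_trans (le_of_eq ?_) this
  have h := (b.coord i).linearMap_vsub x y
  rw [Real.norm_eq_abs]
  congr 1
  simpa using h.symm

/-- Each ray is part of a level line of a barycentric coordinate. This makes
`exists_coarea_majorant` applicable to the jumps met by the rays. -/
lemma coord_one_affineCoords {c d q : Plane} {b : AffineBasis (Fin 3) ℝ Plane}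
    (hb : ⇑b = ![c, d, q]) (s t : ℝ) :
    b.coord 1 (affineCoords c (d - c) (q - c) (s, t)) = s := by
  have hc : b.coord 1 c = 0 := by
    have := b.coord_apply_ne (by decide : (1 : Fin 3) ≠ 0); rwa [hb] at this
  have hd : b.coord 1 d = 1 := by
    have := b.coord_apply_eq 1; rwa [hb] at this
  have hq : b.coord 1 q = 0 := by
    have := b.coord_apply_ne (by decide : (1 : Fin 3) ≠ 2); rwa [hb] at this
  have h1 : ∀ x v : Plane, b.coord 1 (x + v) = (b.coord 1).linear v + b.coord 1 x := by
    intro x v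
    have := (b.coord 1).map_vadd x v
    simpa [add_comm] using this
  have h2 : (b.coord 1).linear (d - c) = 1 := by
    have := (b.coord 1).linearMap_vsub d c
    simpa [hc, hd] using this
  have h3 : (b.coord 1).linear (q - c) = 0 := by
    have := (b.coord 1).linearMap_vsub q c
    simpa [hc, hq] using this
  rw [affineCoords, h1, hc, map_add, map_smul, map_smul, h2, h3]
  simp

namespace Triangulation

variable {Ω : Set Plane} (T : Triangulation Ω)

lemma lineMap_eq_affineCoords (c d q : Plane) (r : ℝ) :
    AffineMap.lineMap c d r = affineCoords c (d - c) (q - c) (r, 0) := by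
  simp [affineCoords, AffineMap.lineMap_apply, add_comm]

/-- The trace inequality on one coordinate segment of a parallelogram, for piecewise smooth
functions and bounds `J` of the jumps. -/
lemma enorm_piecewise_lineMap_le (hΩ : interior (closure Ω) = Ω) {c d q : Plane}
    (hsub : convexHull ℝ {c, d, q} ⊆ closure Ω) {D : ℝ} (hD : dist c q ≤ D)
    {w : Finset Plane → Plane → ℝ} (hw : ∀ s, ContDiff ℝ 1 (w s))
    {r : ℝ} (hr : r ∈ Icc (0:ℝ) (1 / 2))
    (hv : ∀ t, affineCoords c (d - c) (q - c) (r, t) ∉ T.vertexSet)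
    {J : Finset Plane → Finset Plane → ℝ≥0∞}
    (hJ : ∀ e ∈ T.interiorEdges, ∀ k ∈ T.elementsAt e, ∀ l ∈ T.elementsAt e, ∀ t,
      affineCoords c (d - c) (q - c) (r, t) ∈ convexHull ℝ (e : Set Plane) →
      ‖w k (affineCoords c (d - c) (q - c) (r, t)) ^ 2 -
        w l (affineCoords c (d - c) (q - c) (r, t)) ^ 2‖ₑ ≤ J k l)
    (hx : (AffineMap.lineMap c d r : Plane) ∈ frontier Ω) :
    ‖T.piecewise w (AffineMap.lineMap c d r)‖ₑ ^ 2 ≤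
      ∑ k ∈ T.elements, (∫⁻ t in {t | t ∈ Icc (0:ℝ) (1 / 2) ∧
          affineCoords c (d - c) (q - c) (r, t) ∈ convexHull ℝ (k : Set Plane)},
          ENNReal.ofReal (3 + D ^ 2) *
            energyDensity (w k) (affineCoords c (d - c) (q - c) (r, t))) +
        ∑ k ∈ T.elements, ∑ l ∈ T.elements, J k l := by
  classical
  set γ : ℝ → Plane := fun t => affineCoords c (d - c) (q - c) (r, t) with hγ
  have hγc : Continuous γ := (continuous_affineCoords _ _ _).comp (by fun_prop)
  have hlm : (AffineMap.lineMap c d r : Plane) = γ 0 := lineMap_eq_affineCoords c d q r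
  rw [hlm] at hx ⊢
  refine T.enorm_piecewise_le hΩ hx (hv 0) fun i hi hxi => ?_
  have hγa : ∀ x y a b : ℝ, a + b = 1 → γ (a * x + b * y) = a • γ x + b • γ y := by
    intro x y a b hab
    obtain rfl : a = 1 - b := by linarith
    simp only [hγ, affineCoords]
    module
  set I : Finset Plane → Set ℝ := fun k =>
    {t | t ∈ Icc (0:ℝ) (1 / 2) ∧ γ t ∈ convexHull ℝ (k : Set Plane)} with hI
  have hclosed : ∀ k, IsClosed (I k) := fun k =>
    isClosed_Icc.inter ((isCompact_convexHull k).isClosed.preimage hγc)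
  have hmain := enorm_le_variation_add_jumps T.elements I (b := 1 / 2)
    (fun k _ => hclosed k)
    (fun k _ => by
      apply Convex.ordConnected
      rintro x ⟨hx1, hx2⟩ y ⟨hy1, hy2⟩ a b ha hb hab
      refine ⟨convex_Icc _ _ hx1 hy1 ha hb hab, ?_⟩
      simp only [smul_eq_mul]
      rw [hγa _ _ _ _ hab]
      exact convex_convexHull ℝ _ hx2 hy2 ha hb hab)
    (fun k _ t ht => ht.1)
    (fun t ht => by
      have h1 : γ t ∈ closure Ω := by
        apply hsub
        have := affineCoords_mem_convexHull c (d - c) (q - c) hr.1 ht.1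
          (by linarith [hr.2, ht.2])
        simpa using this
      rw [T.closure_eq, mem_iUnion₂] at h1
      obtain ⟨k, hk, hk'⟩ := h1
      exact mem_biUnion hk ⟨ht, hk'⟩)
    (fun k => rayFun c (d - c) (q - c) (w k) r)
    (fun k _ => contDiff_rayFun _ _ _ (hw k) r)
    (fun k _ => rayFun_half _ _ _ _ _) J
    (by
      intro k hk l hl hkl t htk htl
      -- The ray misses all vertices, so two elements that meet on it share an interior edge through
      -- the meeting point. The weight `1 - 2t` is at most `1` in absolute value and only decreases
      -- the jump.
      obtain ⟨c', d', -, hck, hcl, hdk, hdl, hseg, e, he, hecd⟩ :=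
        T.mem_vertexSet_or_card_inter hk hl hkl htk.2 htl.2 (hv t)
      have hek : ∀ s : Finset Plane, c' ∈ s → d' ∈ s → e ⊆ s := by
        intro s hc hd
        rw [← Finset.coe_subset, hecd]
        rintro x (rfl | rfl)
        exacts [hc, hd]
      have hmem : γ t ∈ convexHull ℝ (e : Set Plane) := by rwa [hecd, convexHull_pair]
      refine le_trans ?_ (hJ e he k (T.mem_elementsAt.2 ⟨hk, hek k hck hdk⟩) l
        (T.mem_elementsAt.2 ⟨hl, hek l hcl hdl⟩) t hmem)
      simp only [rayFun]
      rw [← mul_sub, enorm_mul]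
      refine mul_le_of_le_one_left' ?_
      rw [Real.enorm_eq_ofReal_abs, ENNReal.ofReal_le_one, abs_le]
      constructor <;> linarith [htk.1.1, htk.1.2])
    hi ⟨by norm_num, hxi⟩
  rw [rayFun_zero, enorm_pow] at hmain
  have hγ0 : γ 0 = c + r • (d - c) := by simp [hγ, affineCoords]
  rw [hγ0]
  refine hmain.trans (add_le_add (Finset.sum_le_sum fun k hk => ?_)
    (Finset.sum_le_sum fun k hk => Finset.sum_le_sum fun l hl => ?_))
  · refine setLIntegral_mono' (hclosed k).measurableSet fun t ht => ?_
    exact enorm_deriv_rayFun_le _ _ _ (hw k) (by rwa [← dist_eq_norm, dist_comm]) r ht.1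
  · split_ifs
    · exact le_rfl
    · exact zero_le

/-- The trace inequality for piecewise smooth functions, on one half of a side of a triangle in the
closure of the domain. -/
lemma exists_half_segment_bound (hΩ : interior (closure Ω) = Ω) (hΩb : Bornology.IsBounded Ω)
    (κ : ℝ) {c d q : Plane} (hind : AffineIndependent ℝ ![c, d, q])
    (hsub : convexHull ℝ {c, d, q} ⊆ closure Ω) :
    ∃ C : ℝ≥0∞, C ≠ ⊤ ∧ ∀ T : Triangulation Ω, T.shapeRegularity ≤ κ →
      ∀ w : Finset Plane → Plane → ℝ, (∀ s, ContDiff ℝ 1 (w s)) →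
        ∫⁻ x in AffineMap.lineMap c d '' Icc (0 : ℝ) (1 / 2) ∩ frontier Ω,
          ‖T.piecewise w x‖ₑ ^ 2 ∂arcLength ≤ C * (T.elementEnergy w + T.jumpEnergy w) := by
  classical
  obtain ⟨b, hb⟩ := exists_affineBasis_triangle hind
  obtain ⟨L, hL⟩ := exists_lipschitz_coord b 1
  set D := Metric.diam (closure Ω) with hD
  set V := volume (convexHull ℝ {c, d, q}) with hV
  have hV0 : V ≠ 0 :=
    (Measure.measure_pos_of_nonempty_interior _ (interior_triangle_nonempty hind)).ne'
  have hlin := linearIndependent_sides hind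
  have hcd : c ≠ d := fun hcd => by
    have := hind.injective.ne (by decide : (0 : Fin 3) ≠ 1); exact this hcd
  set C₁ := 64 * (2 * ENNReal.ofReal (16 * κ ^ 2) * ENNReal.ofReal (3 + D ^ 2)) with hC₁
  set A := V⁻¹ * ENNReal.ofReal (3 + D ^ 2) with hA
  -- The factor `dist c d` converts the parameter into arc length, `A` pays for the derivatives and
  -- `L * (1 + C₁)` for the jumps. All of them are fixed before the triangulation `T`.
  refine ⟨ENNReal.ofReal (dist c d) * (A + ENNReal.ofReal L * (1 + C₁)), ?_, ?_⟩
  · have : A ≠ ⊤ := ENNReal.mul_ne_top (ENNReal.inv_ne_top.2 hV0) ENNReal.ofReal_ne_top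
    have : C₁ ≠ ⊤ := by rw [hC₁]; finiteness
    finiteness
  intro T hκ w hw
  have hcq : dist c q ≤ D :=
    Metric.dist_le_diam_of_mem hΩb.closure (hsub (subset_convexHull ℝ _ (by simp)))
      (hsub (subset_convexHull ℝ _ (by simp)))
  have hm : ∀ k, Measurable (w k) := fun k => (hw k).continuous.measurable
  have hΦ : ∀ e k l : Finset Plane, ∃ Φ : ℝ → ℝ≥0∞, Measurable Φ ∧ (e ∈ T.interiorEdges →
      ∫⁻ s, Φ s ≤ ENNReal.ofReal L *
        ∫⁻ x in convexHull ℝ (e : Set Plane), ‖w k x ^ 2 - w l x ^ 2‖ₑ ∂arcLength ∧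
      ∀ᵐ s : ℝ, ∀ x ∈ convexHull ℝ (e : Set Plane), b.coord 1 x = s →
        ‖w k x ^ 2 - w l x ^ 2‖ₑ ≤ Φ s) := by
    intro e k l
    by_cases he : e ∈ T.interiorEdges
    · obtain ⟨c', d', -, rfl⟩ := Finset.card_eq_two.1 (T.card_of_mem_interiorEdges he)
      obtain ⟨Φ, h1, h2, h3⟩ := exists_coarea_majorant (b.coord 1) hL c' d'
        (F := fun x => ‖w k x ^ 2 - w l x ^ 2‖ₑ) (((hm k).pow_const 2).sub ((hm l).pow_const 2)).enorm
      rw [Finset.coe_pair, convexHull_pair]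
      exact ⟨Φ, h1, fun _ => ⟨h2, h3⟩⟩
    · exact ⟨0, measurable_zero, fun h => absurd h he⟩
  choose Φ hΦm hΦ using hΦ
  -- Summing over all interior edges common to `k` and `l` gives a bound of the jump without naming
  -- the edge that is crossed.
  set J : ℝ → Finset Plane → Finset Plane → ℝ≥0∞ := fun r k l =>
    ∑ e ∈ T.interiorEdges with e ⊆ k ∧ e ⊆ l, Φ e k l r with hJ
  set R : ℝ → Finset Plane → ℝ≥0∞ := fun r k => ∫⁻ t in {t | t ∈ Icc (0:ℝ) (1 / 2) ∧
          affineCoords c (d - c) (q - c) (r, t) ∈ convexHull ℝ (k : Set Plane)},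
          ENNReal.ofReal (3 + D ^ 2) *
            energyDensity (w k) (affineCoords c (d - c) (q - c) (r, t)) with hR
  have hRm : ∀ k, Measurable fun r => R r k := fun k =>
    measurable_lintegral_rays c (d - c) (q - c) (measurableSet_convexHull k)
      (g := fun x => ENNReal.ofReal (3 + D ^ 2) * energyDensity (w k) x)
      ((measurable_energyDensity (hw k)).const_mul _)
  have hJm : ∀ k l, Measurable fun r => J r k l := fun k l =>
    Finset.measurable_fun_sum _ fun e _ => hΦm e k l
  -- There are finitely many vertices, so only finitely many rays are excluded.
  have hae1 : ∀ᵐ r : ℝ, r ∉ b.coord 1 '' T.vertexSet :=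
    measure_eq_zero_iff_ae_notMem.1 ((T.finite_vertexSet.image _).measure_zero _)
  have hae2 : ∀ᵐ r : ℝ, ∀ e ∈ T.interiorEdges, ∀ k ∈ T.elements, ∀ l ∈ T.elements,
      ∀ x ∈ convexHull ℝ (e : Set Plane), b.coord 1 x = r →
        ‖w k x ^ 2 - w l x ^ 2‖ₑ ≤ Φ e k l r := by
    rw [Filter.eventually_all_finset]; intro e he
    rw [Filter.eventually_all_finset]; intro k _
    rw [Filter.eventually_all_finset]; intro l _
    exact (hΦ e k l he).2
  have hpt : ∀ᵐ r ∂(volume.restrict (Icc (0:ℝ) (1 / 2))),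
      (frontier Ω).indicator (fun x => ‖T.piecewise w x‖ₑ ^ 2) (AffineMap.lineMap c d r) ≤
        ∑ k ∈ T.elements, R r k + ∑ k ∈ T.elements, ∑ l ∈ T.elements, J r k l := by
    filter_upwards [ae_restrict_of_ae hae1, ae_restrict_of_ae hae2,
      ae_restrict_mem measurableSet_Icc] with r h1 h2 hr
    by_cases hx : (AffineMap.lineMap c d r : Plane) ∈ frontier Ω
    · rw [indicator_of_mem hx]
      refine T.enorm_piecewise_lineMap_le hΩ hsub hcq hw hr ?_ ?_ hx
      · intro t ht
        exact h1 ⟨_, ht, coord_one_affineCoords hb r t⟩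
      · intro e he k hk l hl t ht
        rw [mem_elementsAt] at hk hl
        refine (h2 e he k hk.1 l hl.1 _ ht (coord_one_affineCoords hb r t)).trans ?_
        exact Finset.single_le_sum (f := fun e => Φ e k l r) (fun _ _ => zero_le)
          (Finset.mem_filter.2 ⟨he, hk.2, hl.2⟩)
    · rw [indicator_of_notMem hx]; exact zero_le
  have hR' : ∑ k ∈ T.elements, ∫⁻ r in Icc (0:ℝ) (1 / 2), R r k ≤ A * T.elementEnergy w := by
    rw [elementEnergy, Finset.mul_sum]
    refine Finset.sum_le_sum fun k _ => ?_
    refine (lintegral_rays_le c hlin (measurableSet_convexHull k)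
      (g := fun x => ENNReal.ofReal (3 + D ^ 2) * energyDensity (w k) x)
      ((measurable_energyDensity (hw k)).const_mul _)).trans ?_
    rw [lintegral_const_mul _ (measurable_energyDensity (hw k)), ← mul_assoc,
      add_sub_cancel, add_sub_cancel]
  have hJ' : ∑ k ∈ T.elements, ∑ l ∈ T.elements, ∫⁻ r in Icc (0:ℝ) (1 / 2), J r k l ≤
      ENNReal.ofReal L * (T.jumpEnergy w + C₁ * T.elementEnergy w) := by
    refine le_trans ?_ (mul_le_mul_right (T.sum_lintegral_jump_sq_le hΩb hκ hw) _)
    rw [Finset.mul_sum]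
    calc ∑ k ∈ T.elements, ∑ l ∈ T.elements, ∫⁻ r in Icc (0:ℝ) (1 / 2), J r k l
        ≤ ∑ k ∈ T.elements, ∑ l ∈ T.elements, ∑ e ∈ T.interiorEdges with e ⊆ k ∧ e ⊆ l,
            ∫⁻ r, Φ e k l r := by
          refine Finset.sum_le_sum fun k _ => Finset.sum_le_sum fun l _ => ?_
          refine (setLIntegral_le_lintegral _ _).trans ?_
          rw [lintegral_finsetSum _ fun e _ => hΦm e k l]
      _ = ∑ e ∈ T.interiorEdges, ∑ k ∈ T.elementsAt e, ∑ l ∈ T.elementsAt e,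
            ∫⁻ r, Φ e k l r := by
          have h1 : ∀ k, ∑ l ∈ T.elements, ∑ e ∈ T.interiorEdges with e ⊆ k ∧ e ⊆ l,
              ∫⁻ r, Φ e k l r = ∑ e ∈ T.interiorEdges with e ⊆ k, ∑ l ∈ T.elementsAt e,
                ∫⁻ r, Φ e k l r := by
            intro k
            apply Finset.sum_comm'
            intro l e
            simp only [mem_elementsAt, Finset.mem_filter]
            tauto
          rw [Finset.sum_congr rfl fun k _ => h1 k]
          apply Finset.sum_comm'
          intro k e
          simp only [mem_elementsAt, Finset.mem_filter]
          tauto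
      _ ≤ _ := by
          refine Finset.sum_le_sum fun e he => ?_
          simp only [Finset.mul_sum]
          exact Finset.sum_le_sum fun k _ => Finset.sum_le_sum fun l _ => (hΦ e k l he).1
  have hfr : MeasurableSet (frontier Ω) := isClosed_frontier.measurableSet
  rw [inter_comm, ← Measure.restrict_restrict hfr, ← lintegral_indicator hfr,
    lintegral_lineMap_image hcd, mul_assoc]
  refine mul_le_mul_right ?_ _
  refine (lintegral_mono_ae hpt).trans ?_
  rw [lintegral_add_left (Finset.measurable_fun_sum _ fun k _ => hRm k),
    lintegral_finsetSum _ fun k _ => hRm k, lintegral_finsetSum _ fun k _ =>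
      Finset.measurable_fun_sum _ fun l _ => hJm k l]
  simp only [lintegral_finsetSum _ fun l _ => hJm _ l]
  refine (add_le_add hR' hJ').trans ?_
  set E := T.elementEnergy w
  set F := T.jumpEnergy w
  -- Nonnegative terms are added so that both energies carry the same constant.
  calc A * E + ENNReal.ofReal L * (F + C₁ * E)
      ≤ A * E + ENNReal.ofReal L * (F + C₁ * E) + (A * F + ENNReal.ofReal L * (E + C₁ * F)) :=
        le_self_add
    _ = _ := by ring

end Triangulation

lemma affineIndependent_swap {c d q : Plane} (h : AffineIndependent ℝ ![c, d, q]) :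
    AffineIndependent ℝ ![d, c, q] := by
  have := h.comp_embedding (Equiv.swap (0 : Fin 3) 1).toEmbedding
  have e : ![d, c, q] = (![c, d, q] ∘ (Equiv.swap (0 : Fin 3) 1).toEmbedding) := by
    ext i
    fin_cases i <;> simp [Equiv.swap_apply_def]
  rw [e]; exact this

/-- The trace inequality on the part of `∂Ω` in `B`, for piecewise smooth functions. -/
def HasBoundaryBound (Ω : Set Plane) (κ : ℝ) (B : Set Plane) : Prop :=
  ∃ C : ℝ≥0∞, C ≠ ⊤ ∧ ∀ T : Triangulation Ω, T.shapeRegularity ≤ κ →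
    ∀ w : Finset Plane → Plane → ℝ, (∀ s, ContDiff ℝ 1 (w s)) →
      ∫⁻ x in B ∩ frontier Ω, ‖T.piecewise w x‖ₑ ^ 2 ∂arcLength ≤
        C * (T.elementEnergy w + T.jumpEnergy w)

namespace HasBoundaryBound

variable {Ω : Set Plane} {κ : ℝ}

lemma mono {A B : Set Plane} (hB : HasBoundaryBound Ω κ B) (h : A ⊆ B) :
    HasBoundaryBound Ω κ A := by
  obtain ⟨C, hC, hB⟩ := hB
  exact ⟨C, hC, fun T hT w hw =>
    (lintegral_mono_set (inter_subset_inter_left _ h)).trans (hB T hT w hw)⟩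

lemma union {A B : Set Plane} (hA : HasBoundaryBound Ω κ A) (hB : HasBoundaryBound Ω κ B) :
    HasBoundaryBound Ω κ (A ∪ B) := by
  obtain ⟨C, hC, hA⟩ := hA
  obtain ⟨C', hC', hB⟩ := hB
  refine ⟨C + C', ENNReal.add_ne_top.2 ⟨hC, hC'⟩, fun T hT w hw => ?_⟩
  rw [union_inter_distrib_right, add_mul]
  exact (lintegral_union_le _ _ _).trans (add_le_add (hA T hT w hw) (hB T hT w hw))

lemma biUnion {ι : Type*} (S : Finset ι) (A : ι → Set Plane)
    (h : ∀ i ∈ S, HasBoundaryBound Ω κ (A i)) : HasBoundaryBound Ω κ (⋃ i ∈ S, A i) := by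
  classical
  induction S using Finset.induction_on with
  | empty => exact ⟨0, by simp, fun T _ w _ => by simp⟩
  | insert i S _ ih =>
    rw [Finset.set_biUnion_insert]
    exact (h i (by simp)).union (ih fun j hj => h j (by simp [hj]))

end HasBoundaryBound

/-- The trace inequality for piecewise smooth functions. -/
lemma hasBoundaryBound_frontier {Ω : Set Plane} (hΩ : interior (closure Ω) = Ω)
    (hΩb : Bornology.IsBounded Ω) (κ : ℝ) (T : Triangulation Ω) :
    HasBoundaryBound Ω κ (frontier Ω) := by
  have hseg : ∀ {c d q : Plane}, AffineIndependent ℝ ![c, d, q] →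
      convexHull ℝ {c, d, q} ⊆ closure Ω → HasBoundaryBound Ω κ (segment ℝ c d) := by
    intro c d q hind hsub
    refine HasBoundaryBound.mono (HasBoundaryBound.union ?_ ?_) (segment_subset_halves c d)
    · exact Triangulation.exists_half_segment_bound hΩ hΩb κ hind hsub
    · exact Triangulation.exists_half_segment_bound hΩ hΩb κ (affineIndependent_swap hind)
        (by rwa [insert_comm])
  -- Here `T` only supplies finitely many sides that cover `∂Ω`, with triangles inside the closure
  -- of `Ω`; the bound obtained concerns every triangulation with shape regularity constant at most
  -- `κ`.
  refine (HasBoundaryBound.biUnion T.elements (fun s => frontier (openTriangle s)) ?_).mono ?_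
  · intro s hs
    obtain ⟨c, d, q, hq, hind⟩ := exists_vertices (T.affineIndependent hs) (T.mem_elements.1 hs).2
    have hsub := T.convexHull_subset_closure hs
    rw [hq] at hsub
    rw [openTriangle, hq]
    refine HasBoundaryBound.mono ?_ (frontier_interior_triangle_subset hind)
    have h2 := affineIndependent_rotate hind
    have h3 := affineIndependent_rotate h2
    have e2 : ({d, q, c} : Set Plane) = {c, d, q} := by ext; simp; tauto
    have e3 : ({q, c, d} : Set Plane) = {c, d, q} := by ext; simp; tauto
    exact ((hseg hind hsub).union (hseg h2 (by rwa [e2]))).union (hseg h3 (by rwa [e3]))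
  · intro x hx
    have hx' := frontier_subset_closure hx
    rw [T.closure_eq, mem_iUnion₂] at hx'
    obtain ⟨s, hs, hxs⟩ := hx'
    refine mem_biUnion hs ?_
    obtain ⟨c, d, q, hq, hind⟩ := exists_vertices (T.affineIndependent hs) (T.mem_elements.1 hs).2
    have hdis := Triangulation.frontier_inter_interior hΩ (T.convexHull_subset_closure hs)
    change x ∈ frontier (openTriangle s)
    rw [openTriangle, hq, frontier_interior_triangle hind, ← hq]
    exact ⟨hxs, fun h => hdis.le_bot ⟨hx, h⟩⟩

/-! ### Smoothing of square integrable functions -/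

open scoped Convolution

lemma eLpNorm_two_sq {α E : Type*} [MeasurableSpace α] [NormedAddCommGroup E] (μ : Measure α)
    (f : α → E) : eLpNorm f 2 μ ^ 2 = ∫⁻ x, ‖f x‖ₑ ^ 2 ∂μ := by
  have := eLpNorm_nnreal_pow_eq_lintegral (f := f) (μ := μ) (p := 2) (by norm_num)
  simpa using this

/-- The contraction of the plane towards `z` with the ratio `1 - 1 / (n + 2)`. -/
def contraction (z : Plane) (n : ℕ) (x : Plane) : Plane := z + (1 - 1 / ((n : ℝ) + 2)) • (x - z)

/-- A bump function with support in the ball of radius `ρ / (n + 2)`. -/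
def mollifier {ρ : ℝ} (hρ : 0 < ρ) (n : ℕ) : ContDiffBump (0 : Plane) where
  rIn := ρ / (n + 2) / 2
  rOut := ρ / (n + 2)
  rIn_pos := by positivity
  rIn_lt_rOut := half_lt_self (by positivity)

section Smoothing

variable {E : Type*} [NormedAddCommGroup E] [NormedSpace ℝ E]

/-- The smoothing of a function: mollification after a contraction towards `z`. -/
def smoothing (z : Plane) {ρ : ℝ} (hρ : 0 < ρ) (n : ℕ) (f : Plane → E) (x : Plane) : E :=
  ((mollifier hρ n).normed volume ⋆[ContinuousLinearMap.lsmul ℝ ℝ, volume] f) (contraction z n x)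

variable (z : Plane) {ρ : ℝ} (hρ : 0 < ρ) (n : ℕ)

/-- The ratio of the contraction is at least `1/2`, so in the plane the change of variables costs at
most `2²`. -/
lemma lintegral_contraction_le (f : Plane → ℝ≥0∞) :
    ∫⁻ x, f (contraction z n x) ≤ 4 * ∫⁻ x, f x := by
  set r : ℝ := 1 - 1 / ((n : ℝ) + 2) with hr
  have hr2 : 1 / 2 ≤ r := by
    have : 1 / ((n : ℝ) + 2) ≤ 1 / 2 := by
      apply one_div_le_one_div_of_le (by norm_num); linarith [(Nat.cast_nonneg n : (0:ℝ) ≤ n)]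
    linarith
  have hr0 : r ≠ 0 := by linarith
  have hme : MeasurableEmbedding fun x : Plane => r • x :=
    (Homeomorph.smulOfNeZero r hr0).measurableEmbedding
  have h1 : ∫⁻ x, f (contraction z n x) = ∫⁻ x, f (z + r • x) :=
    lintegral_sub_right_eq_self (μ := volume) (fun x => f (z + r • x)) z
  have h2 : ∫⁻ x, f (z + r • x) = ∫⁻ x, f (z + x) ∂(volume.map fun x : Plane => r • x) := by
    rw [hme.lintegral_map]
  rw [h1, h2, Measure.map_addHaar_smul _ hr0, lintegral_smul_measure, smul_eq_mul,
    lintegral_add_left_eq_self (μ := volume) f z]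
  gcongr
  rw [← ENNReal.ofReal_ofNat 4]
  apply ENNReal.ofReal_le_ofReal
  rw [finrank_euclideanSpace_fin, abs_of_pos (by positivity), inv_le_comm₀ (by positivity) (by norm_num)]
  nlinarith

lemma lintegral_normed (φ : ContDiffBump (0 : Plane)) :
    ∫⁻ t, ENNReal.ofReal (φ.normed volume t) = 1 := by
  rw [← ofReal_integral_eq_lintegral_ofReal φ.integrable_normed
    (Eventually.of_forall φ.nonneg_normed), φ.integral_normed, ENNReal.ofReal_one]

/-- Mollification is a contraction of `L²`. -/
lemma lintegral_convolution_sq_le (φ : ContDiffBump (0 : Plane)) {f : Plane → E}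
    (hf : StronglyMeasurable f) :
    ∫⁻ x, ‖(φ.normed volume ⋆[ContinuousLinearMap.lsmul ℝ ℝ, volume] f) x‖ₑ ^ 2 ≤
      ∫⁻ x, ‖f x‖ₑ ^ 2 := by
  set p : Plane → ℝ≥0∞ := fun t => ENNReal.ofReal (φ.normed volume t) with hp
  have hpm : Measurable p := φ.continuous_normed.measurable.ennreal_ofReal
  have hfm : Measurable fun x => ‖f x‖ₑ := hf.enorm
  have hpt : ∀ x, ‖(φ.normed volume ⋆[ContinuousLinearMap.lsmul ℝ ℝ, volume] f) x‖ₑ ^ 2 ≤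
      ∫⁻ t, p t * ‖f (x - t)‖ₑ ^ 2 := by
    intro x
    have hgm : Measurable fun t => ‖f (x - t)‖ₑ := hfm.comp (measurable_const.sub measurable_id)
    have h1 : ‖(φ.normed volume ⋆[ContinuousLinearMap.lsmul ℝ ℝ, volume] f) x‖ₑ ≤
        ∫⁻ t, p t * ‖f (x - t)‖ₑ := by
      rw [convolution_def]
      refine (enorm_integral_le_lintegral_enorm _).trans (le_of_eq (lintegral_congr fun t => ?_))
      rw [ContinuousLinearMap.lsmul_apply, enorm_smul, Real.enorm_of_nonneg (φ.nonneg_normed t)]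
    -- The mollifier is a probability density, so Cauchy-Schwarz against the constant `1` bounds the
    -- square of the average by the average of the squares.
    have h2 := ENNReal.lintegral_mul_le_Lp_mul_Lq (volume.withDensity p)
      (Real.HolderConjugate.two_two) (f := fun _ => 1) (g := fun t => ‖f (x - t)‖ₑ)
      aemeasurable_const hgm.aemeasurable
    have h3 : ∫⁻ t, p t * ‖f (x - t)‖ₑ ≤ (∫⁻ t, p t * ‖f (x - t)‖ₑ ^ 2) ^ (1 / 2 : ℝ) := by
      have e : ∀ g : Plane → ℝ≥0∞, Measurable g →
          ∫⁻ t, g t ∂(volume.withDensity p) = ∫⁻ t, p t * g t := fun g hg => by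
        rw [lintegral_withDensity_eq_lintegral_mul _ hpm hg]; rfl
      simp only [Pi.mul_apply, one_mul, ENNReal.one_rpow, lintegral_const] at h2
      rw [e _ hgm, e _ (hgm.pow_const _), withDensity_apply _ MeasurableSet.univ,
        Measure.restrict_univ, lintegral_normed] at h2
      simpa using h2
    calc _ ≤ ((∫⁻ t, p t * ‖f (x - t)‖ₑ ^ 2) ^ (1 / 2 : ℝ)) ^ 2 := by gcongr; exact h1.trans h3
      _ = _ := by
        rw [← ENNReal.rpow_natCast, ← ENNReal.rpow_mul]; norm_num
  refine (lintegral_mono hpt).trans ?_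
  rw [lintegral_lintegral_swap]
  · have : ∀ t, ∫⁻ x, p t * ‖f (x - t)‖ₑ ^ 2 = p t * ∫⁻ x, ‖f x‖ₑ ^ 2 := by
      intro t
      rw [lintegral_const_mul _ (by
        exact (hfm.comp (measurable_id.sub measurable_const)).pow_const 2)]
      rw [lintegral_sub_right_eq_self (μ := volume) (fun x => ‖f x‖ₑ ^ 2) t]
    simp only [this]
    rw [lintegral_mul_const _ hpm, lintegral_normed, one_mul]
  · apply Measurable.aemeasurable
    exact (hpm.comp measurable_snd).mul
      ((hfm.comp (measurable_fst.sub measurable_snd)).pow_const 2)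

lemma smoothing_congr {f g : Plane → E} (h : f =ᵐ[volume] g) :
    smoothing z hρ n f = smoothing z hρ n g := by
  ext x
  unfold smoothing
  rw [convolution_congr _ (ae_eq_refl _) h]

/-- Mollification costs nothing and contraction a factor `4` for the square of the norm. Uniformity
in `n` is what the density argument in `tendsto_smoothing` needs. -/
lemma eLpNorm_smoothing_le {f : Plane → E} (hf : AEStronglyMeasurable f volume) :
    eLpNorm (smoothing z hρ n f) 2 volume ≤ 2 * eLpNorm f 2 volume := by
  obtain ⟨g, hg, hfg⟩ := hf
  rw [smoothing_congr z hρ n hfg, eLpNorm_congr_ae hfg]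
  have h1 := (lintegral_contraction_le z n fun x =>
    ‖((mollifier hρ n).normed volume ⋆[ContinuousLinearMap.lsmul ℝ ℝ, volume] g) x‖ₑ ^ 2).trans
      (mul_le_mul_right (lintegral_convolution_sq_le (mollifier hρ n) hg) 4)
  have h2 : eLpNorm (smoothing z hρ n g) 2 volume ^ 2 ≤ (2 * eLpNorm g 2 volume) ^ 2 := by
    rw [mul_pow, eLpNorm_two_sq, eLpNorm_two_sq]
    refine h1.trans (le_of_eq ?_)
    norm_num
  exact (ENNReal.pow_le_pow_left_iff (by norm_num)).1 h2

lemma smoothing_add {f g : Plane → E} (hf : LocallyIntegrable f volume)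
    (hg : LocallyIntegrable g volume) :
    smoothing z hρ n (f + g) = smoothing z hρ n f + smoothing z hρ n g := by
  ext x
  have h : ∀ f : Plane → E, LocallyIntegrable f volume →
      ConvolutionExists ((mollifier hρ n).normed volume) f
        (ContinuousLinearMap.lsmul ℝ ℝ) volume := fun f hf =>
    (mollifier hρ n).hasCompactSupport_normed.convolutionExists_left _
      (mollifier hρ n).continuous_normed hf
  unfold smoothing
  rw [(h f hf).distrib_add (h g hg)]
  rfl

lemma tendsto_one_div_add_two : Tendsto (fun n : ℕ => 1 / ((n : ℝ) + 2)) atTop (𝓝 0) := by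
  have := (tendsto_one_div_add_atTop_nhds_zero_nat (𝕜 := ℝ)).comp (tendsto_add_atTop_nat 1)
  refine this.congr fun n => ?_
  simp; ring

lemma dist_contraction (x : Plane) : dist (contraction z n x) x = 1 / ((n : ℝ) + 2) * dist x z := by
  have : contraction z n x - x = -((1 / ((n : ℝ) + 2)) • (x - z)) := by
    unfold contraction; module
  rw [dist_eq_norm, this, norm_neg, norm_smul, dist_eq_norm, Real.norm_of_nonneg (by positivity)]

lemma dist_contraction_center (x : Plane) :
    dist (contraction z n x) z = (1 - 1 / ((n : ℝ) + 2)) * dist x z := by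
  have h : 0 ≤ 1 - 1 / ((n : ℝ) + 2) := by
    have : 1 / ((n : ℝ) + 2) ≤ 1 := by
      rw [div_le_one (by positivity)]; linarith [(Nat.cast_nonneg n : (0:ℝ) ≤ n)]
    linarith
  rw [contraction, dist_eq_norm, add_sub_cancel_left, norm_smul, dist_eq_norm,
    Real.norm_of_nonneg h]

/-- Uniform continuity gives uniform convergence, and all the smoothings are supported in one fixed
ball, so convergence in `L²` follows. -/
lemma tendsto_smoothing_of_continuous [CompleteSpace E] {g : Plane → E} (hg : Continuous g)
    (hgs : HasCompactSupport g) :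
    Tendsto (fun n => eLpNorm (fun x => smoothing z hρ n g x - g x) 2 volume) atTop (𝓝 0) := by
  obtain ⟨R, hR0, hR⟩ : ∃ R : ℝ, 0 < R ∧ tsupport g ⊆ Metric.ball z R := by
    obtain ⟨R, hR⟩ := hgs.isCompact.isBounded.subset_ball z
    exact ⟨max R 1, by positivity, hR.trans (Metric.ball_subset_ball (le_max_left _ _))⟩
  have hzero : ∀ x, R ≤ dist x z → g x = 0 := fun x hx => by
    refine image_eq_zero_of_notMem_tsupport fun h => ?_
    exact absurd (hR h) (by simpa using hx)
  have huc : UniformContinuous g := 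
    hg.uniformContinuous_of_tendsto_cocompact hgs.is_zero_at_infty
  -- A point outside this ball is still farther than `R + ρ` from `z` after contraction, and the
  -- mollifier reaches no farther than `ρ`, so both functions vanish there.
  set B := Metric.closedBall z (2 * (R + ρ)) with hB
  -- One `δ` is for the mollification and one for the displacement by the contraction.
  have key : ∀ δ > 0, ∀ᶠ n in atTop, ∀ x, ‖smoothing z hρ n g x - g x‖ ≤
      ‖B.indicator (fun _ => (2 * δ : ℝ)) x‖ := by
    intro δ hδ
    obtain ⟨η, hη, hu⟩ := Metric.uniformContinuous_iff.1 huc δ hδ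
    have ht : Tendsto (fun n : ℕ => 1 / ((n : ℝ) + 2) * (2 * (R + ρ) + ρ)) atTop (𝓝 0) := by
      simpa using tendsto_one_div_add_two.mul_const (2 * (R + ρ) + ρ)
    filter_upwards [ht.eventually_lt_const hη] with n hn x
    have hn0 : 0 < 1 / ((n : ℝ) + 2) := by positivity
    have hout : (mollifier hρ n).rOut = 1 / ((n : ℝ) + 2) * ρ := by
      change ρ / ((n:ℝ) + 2) = _; ring
    have hhalf : 1 / ((n : ℝ) + 2) ≤ 1 / 2 := by
      apply one_div_le_one_div_of_le (by norm_num); linarith [(Nat.cast_nonneg n : (0:ℝ) ≤ n)]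
    set ν := 1 / ((n : ℝ) + 2) with hν
    by_cases hx : x ∈ B
    · rw [indicator_of_mem hx, Real.norm_of_nonneg (by positivity), ← dist_eq_norm, two_mul]
      rw [hB, Metric.mem_closedBall] at hx
      refine (dist_triangle _ (g (contraction z n x)) _).trans (add_le_add ?_ ?_)
      · refine (mollifier hρ n).dist_normed_convolution_le hg.aestronglyMeasurable fun y hy => ?_
        rw [Metric.mem_ball, hout] at hy
        refine (hu (hy.trans ?_)).le
        nlinarith
      · refine (hu ?_).le
        rw [dist_contraction]
        nlinarith
    · rw [indicator_of_notMem hx, norm_zero]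
      rw [hB, Metric.mem_closedBall, not_le] at hx
      have h1 : g x = 0 := hzero x (by linarith)
      have h2 : smoothing z hρ n g x = 0 := by
        have hd := dist_contraction_center z n x
        have hfar : ∀ y ∈ Metric.ball (contraction z n x) (mollifier hρ n).rOut, g y = 0 := by
          intro y hy
          rw [Metric.mem_ball, hout] at hy
          apply hzero
          have := dist_triangle (contraction z n x) y z
          rw [dist_comm (contraction z n x) y, hd] at this
          nlinarith
        have hcc : g (contraction z n x) = 0 :=
          hfar _ (Metric.mem_ball_self (mollifier hρ n).rOut_pos)
        unfold smoothing
        rw [(mollifier hρ n).normed_convolution_eq_right fun y hy => by rw [hfar y hy, hcc], hcc]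
      rw [h1, h2]; simp
  have hBfin : volume B ≠ ⊤ := measure_closedBall_lt_top.ne
  rw [ENNReal.tendsto_nhds_zero]
  intro ε hε
  have hlim : Tendsto (fun δ : ℝ => ENNReal.ofReal (2 * δ) * volume B ^ (1 / (2:ℝ≥0∞).toReal))
      (𝓝[>] 0) (𝓝 0) := by
    have h1 : Tendsto (fun δ : ℝ => ENNReal.ofReal (2 * δ)) (𝓝[>] 0) (𝓝 0) := by
      have : Tendsto (fun δ : ℝ => 2 * δ) (𝓝[>] 0) (𝓝 (2 * 0)) :=
        (tendsto_id.const_mul 2).mono_left nhdsWithin_le_nhds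
      simpa using ENNReal.tendsto_ofReal this
    have := ENNReal.Tendsto.mul_const h1
      (Or.inr (ENNReal.rpow_ne_top_of_nonneg (by positivity) hBfin :
        volume B ^ (1 / (2:ℝ≥0∞).toReal) ≠ ⊤))
    simpa using this
  obtain ⟨δ, hδ1, hδ⟩ := ((ENNReal.tendsto_nhds_zero.1 hlim ε hε).and self_mem_nhdsWithin).exists
  filter_upwards [key δ hδ] with n hn
  refine (eLpNorm_mono hn).trans (le_trans ?_ hδ1)
  refine (eLpNorm_indicator_const_le _ _).trans ?_
  rw [Real.enorm_of_nonneg (by have : 0 < δ := hδ; positivity)]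

/-- The smoothings of a square integrable function converge to it in `L²`. -/
lemma tendsto_smoothing [CompleteSpace E] {f : Plane → E} (hf : MemLp f 2 volume) :
    Tendsto (fun n => eLpNorm (fun x => smoothing z hρ n f x - f x) 2 volume) atTop (𝓝 0) := by
  rw [ENNReal.tendsto_nhds_zero]
  intro ε hε
  by_cases hεt : ε = ⊤
  · simp [hεt]
  -- The error is split as `2 * (ε / 4) + ε / 4 + ε / 4`; the factor `2` is the norm bound for the
  -- smoothing of `f - g`.
  obtain ⟨g, hgs, hfg, hgc, hgm⟩ := hf.exists_hasCompactSupport_eLpNorm_sub_le (by simp)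
    (ε := ε / 4) (by simp [hε.ne'])
  have hlim := tendsto_smoothing_of_continuous z hρ hgc hgs
  filter_upwards [ENNReal.tendsto_nhds_zero.1 hlim (ε / 4) (by simp [hε.ne'])] with n hn
  have hdm : AEStronglyMeasurable (f - g) volume := hf.1.sub hgm.1
  have hsm : ∀ h : Plane → E, LocallyIntegrable h volume →
      AEStronglyMeasurable (smoothing z hρ n h) volume := by
    intro h hh
    have hc : Continuous (smoothing z hρ n h) := by
      unfold smoothing
      refine Continuous.comp (g := ((mollifier hρ n).normed volume
        ⋆[ContinuousLinearMap.lsmul ℝ ℝ, volume] h)) ?_ (by unfold contraction; fun_prop)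
      exact (mollifier hρ n).hasCompactSupport_normed.continuous_convolution_left _
        (mollifier hρ n).continuous_normed hh
    exact hc.aestronglyMeasurable
  have hli : ∀ h : Plane → E, MemLp h 2 volume → LocallyIntegrable h volume := fun h hh =>
    hh.locallyIntegrable (by norm_num)
  have e : (fun x => smoothing z hρ n f x - f x) =
      (smoothing z hρ n (f - g) + fun x => smoothing z hρ n g x - g x) + (g - f) := by
    ext x
    have := congrFun (smoothing_add z hρ n (hli _ (hf.sub hgm)) (hli _ hgm)) x
    rw [sub_add_cancel] at this
    simp only [this, Pi.add_apply, Pi.sub_apply]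
    abel
  rw [e]
  have h1 := eLpNorm_smoothing_le z hρ n hdm
  have h3 : eLpNorm (g - f) 2 volume ≤ ε / 4 := by rwa [eLpNorm_sub_comm]
  calc _ ≤ (eLpNorm (smoothing z hρ n (f - g)) 2 volume +
        eLpNorm (fun x => smoothing z hρ n g x - g x) 2 volume) + eLpNorm (g - f) 2 volume := by
        refine (eLpNorm_add_le ((hsm _ (hli _ (hf.sub hgm))).add
          ((hsm _ (hli _ hgm)).sub hgm.1)) (hgm.1.sub hf.1) (by norm_num)).trans ?_
        gcongr
        exact eLpNorm_add_le (hsm _ (hli _ (hf.sub hgm))) ((hsm _ (hli _ hgm)).sub hgm.1)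
          (by norm_num)
    _ ≤ (2 * (ε / 4) + ε / 4) + ε / 4 := by
        gcongr
        exact h1.trans (by gcongr)
    _ = 4 * (ε / 4) := by ring
    _ = ε := ENNReal.mul_div_cancel (by norm_num) (by norm_num)

end Smoothing

/-! ### Density of smooth functions in `H¹` of a convex open set. -/

open scoped Convolution

/-- The gradient of a mollification is the mollification of the weak gradient. -/
lemma fderiv_convolution_of_isWeakGradient {U : Set Plane} (hU : IsOpen U) {u : Plane → ℝ}
    {G : Plane → Plane} (hu : LocallyIntegrable (U.indicator u) volume)
    (hG : LocallyIntegrable (U.indicator G) volume) (hw : IsWeakGradient U u G)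
    (φ : ContDiffBump (0 : Plane)) {ξ : Plane} (hξ : Metric.closedBall ξ φ.rOut ⊆ U) (v : Plane) :
    fderiv ℝ (φ.normed volume ⋆[ContinuousLinearMap.lsmul ℝ ℝ, volume] U.indicator u) ξ v =
      inner ℝ ((φ.normed volume ⋆[ContinuousLinearMap.lsmul ℝ ℝ, volume] U.indicator G) ξ) v := by
  set p : Plane → ℝ := φ.normed volume with hp
  have hpc : ContDiff ℝ ∞ p := φ.contDiff_normed
  have hpc1 : ContDiff ℝ 1 p := φ.contDiff_normed
  have hps : HasCompactSupport p := φ.hasCompactSupport_normed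
  set L := ContinuousLinearMap.lsmul ℝ ℝ (E := ℝ) with hL
  rw [(hps.hasFDerivAt_convolution_left L hpc1 hu ξ).fderiv, convolution_def]
  have hint : Integrable (fun t => (L.precompL Plane) (fderiv ℝ p t) (U.indicator u (ξ - t)))
      volume := (hps.fderiv ℝ).convolutionExists_left (L.precompL Plane)
        (hpc1.continuous_fderiv one_ne_zero) hu ξ
  rw [ContinuousLinearMap.integral_apply hint]
  simp only [ContinuousLinearMap.precompL_apply, hL, ContinuousLinearMap.lsmul_apply, smul_eq_mul]
  have e1 : ∫ t, fderiv ℝ p t v * U.indicator u (ξ - t) =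
      ∫ y in U, u y * fderiv ℝ p (ξ - y) v := by
    rw [← integral_sub_left_eq_self (fun t => fderiv ℝ p t v * U.indicator u (ξ - t)) volume ξ,
      ← integral_indicator hU.measurableSet]
    refine integral_congr_ae (Eventually.of_forall fun y => ?_)
    by_cases hy : y ∈ U <;> simp [hy, mul_comm]
  -- The reflected and translated mollifier is an admissible test function, because the closed ball
  -- around `ξ` that contains its support is inside `U`.
  set ψ : Plane → ℝ := fun y => p (ξ - y) with hψ
  have hψd : ∀ y, fderiv ℝ ψ y v = -fderiv ℝ p (ξ - y) v := by
    intro y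
    have h1 : HasFDerivAt (fun y : Plane => ξ - y) (-(ContinuousLinearMap.id ℝ Plane)) y :=
      (hasFDerivAt_id y).const_sub ξ
    have h2 := ((hpc1.differentiable one_ne_zero (ξ - y)).hasFDerivAt).comp y h1
    have h3 : fderiv ℝ ψ y = _ := h2.fderiv
    rw [h3]; simp
  have hsupp : tsupport ψ ⊆ Metric.closedBall ξ φ.rOut := by
    refine closure_minimal (fun y hy => ?_) Metric.isClosed_closedBall
    have : ξ - y ∈ tsupport p := subset_tsupport _ hy
    rw [hp, φ.tsupport_normed_eq, mem_closedBall_zero_iff] at this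
    rwa [Metric.mem_closedBall, dist_comm, dist_eq_norm]
  have hψs : HasCompactSupport ψ :=
    HasCompactSupport.of_support_subset_isCompact (isCompact_closedBall ξ φ.rOut)
      ((subset_tsupport _).trans hsupp)
  have hψc : ContDiff ℝ ∞ ψ := hpc.comp (contDiff_const.sub contDiff_id)
  have hweak := hw ψ hψc hψs (hsupp.trans hξ) v
  simp only [hψd, mul_neg] at hweak
  rw [integral_neg, neg_inj] at hweak
  rw [e1, hweak, convolution_def, real_inner_comm]
  have hint2 : Integrable (fun t => ContinuousLinearMap.lsmul ℝ ℝ (p t) (U.indicator G (ξ - t)))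
      volume := hps.convolutionExists_left (ContinuousLinearMap.lsmul ℝ ℝ)
        hpc.continuous hG ξ
  rw [← integral_inner hint2,
    ← integral_sub_left_eq_self (fun t => inner ℝ v (ContinuousLinearMap.lsmul ℝ ℝ (p t)
      (U.indicator G (ξ - t)))) volume ξ, ← integral_indicator hU.measurableSet]
  refine integral_congr_ae (Eventually.of_forall fun y => ?_)
  by_cases hy : y ∈ U
  · simp [hy, hψ, inner_smul_right, real_inner_comm, mul_comm]
  · simp [hy]

lemma contDiff_smoothing (z : Plane) {ρ : ℝ} (hρ : 0 < ρ) (n : ℕ) {f : Plane → ℝ}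
    (hf : LocallyIntegrable f volume) : ContDiff ℝ ∞ (smoothing z hρ n f) := by
  unfold smoothing
  refine ContDiff.comp (g := ((mollifier hρ n).normed volume
    ⋆[ContinuousLinearMap.lsmul ℝ ℝ, volume] f)) ?_ (by unfold contraction; fun_prop)
  exact (mollifier hρ n).hasCompactSupport_normed.contDiff_convolution_left _
    (mollifier hρ n).contDiff_normed hf

/-- Functions smooth up to the boundary are dense in `H¹` of a convex open set. -/
lemma exists_smooth_approx {U : Set Plane} (hU : IsOpen U) (hconv : Convex ℝ U)
    (hne : U.Nonempty) {u : Plane → ℝ} {G : Plane → Plane} (hu : MemLp u 2 (volume.restrict U))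
    (hG : MemLp G 2 (volume.restrict U)) (hw : IsWeakGradient U u G) :
    ∃ w : ℕ → Plane → ℝ, (∀ n, ContDiff ℝ ∞ (w n)) ∧
      Tendsto (fun n => eLpNorm (fun x => w n x - u x) 2 (volume.restrict U)) atTop (𝓝 0) ∧
      Tendsto (fun n => eLpNorm (fun x => gradient (w n) x - G x) 2 (volume.restrict U))
        atTop (𝓝 0) := by
  obtain ⟨z, hz⟩ := hne
  obtain ⟨ρ, hρ, hball⟩ := Metric.nhds_basis_closedBall.mem_iff.1 (hU.mem_nhds hz)
  have hu' : MemLp (U.indicator u) 2 volume := (memLp_indicator_iff_restrict hU.measurableSet).2 hu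
  have hG' : MemLp (U.indicator G) 2 volume := (memLp_indicator_iff_restrict hU.measurableSet).2 hG
  have hul := hu'.locallyIntegrable (by norm_num)
  have hGl := hG'.locallyIntegrable (by norm_num)
  refine ⟨fun n => smoothing z hρ n (U.indicator u), fun n => contDiff_smoothing z hρ n hul,
    ?_, ?_⟩
  · refine tendsto_of_tendsto_of_tendsto_of_le_of_le tendsto_const_nhds
      (tendsto_smoothing z hρ hu') (fun _ => zero_le) fun n => ?_
    refine le_trans (le_of_eq (eLpNorm_congr_ae ?_)) (eLpNorm_mono_measure _ Measure.restrict_le_self)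
    filter_upwards [ae_restrict_mem hU.measurableSet] with x hx
    rw [indicator_of_mem hx]
  · have hgrad : ∀ n, ∀ x ∈ U, gradient (smoothing z hρ n (U.indicator u)) x =
        (1 - 1 / ((n : ℝ) + 2)) • smoothing z hρ n (U.indicator G) x := by
      intro n x hx
      set r : ℝ := 1 - 1 / ((n : ℝ) + 2) with hr
      have hν : 1 / ((n : ℝ) + 2) ≤ 1 := by
        rw [div_le_one (by positivity)]; linarith [(Nat.cast_nonneg n : (0:ℝ) ≤ n)]
      have hν0 : 0 < 1 / ((n : ℝ) + 2) := by positivity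
      have hsub : Metric.closedBall (contraction z n x) (mollifier hρ n).rOut ⊆ U := by
        intro y hy
        rw [Metric.mem_closedBall, dist_eq_norm] at hy
        change _ ≤ ρ / ((n:ℝ) + 2) at hy
        -- By convexity: a point `y` of the small ball is the convex combination of `x` and `t` with
        -- weights `1 - 1 / (n + 2)` and `1 / (n + 2)`, and `t` is in the ball of radius `ρ` around
        -- `z`. The mollification radius is chosen for this.
        set t : Plane := z + ((n : ℝ) + 2) • (y - contraction z n x) with ht
        have htU : t ∈ U := by
          apply hball
          rw [Metric.mem_closedBall, dist_eq_norm, ht, add_sub_cancel_left, norm_smul,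
            Real.norm_of_nonneg (by positivity)]
          rwa [le_div_iff₀' (by positivity)] at hy
        have := hconv hx htU (by linarith : 0 ≤ r) hν0.le (by rw [hr]; ring)
        convert this using 1
        rw [ht, smul_add, smul_smul, one_div, inv_mul_cancel₀ (by positivity)]
        simp only [contraction, hr, one_div]
        module
      have hc : HasFDerivAt (contraction z n) (r • ContinuousLinearMap.id ℝ Plane) x := by
        unfold contraction
        exact (((hasFDerivAt_id x).sub_const z).const_smul r).const_add z
      set M := (mollifier hρ n).normed volume ⋆[ContinuousLinearMap.lsmul ℝ ℝ, volume]
        U.indicator u with hM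
      have hMd : DifferentiableAt ℝ M (contraction z n x) :=
        ((mollifier hρ n).hasCompactSupport_normed.hasFDerivAt_convolution_left _
          (mollifier hρ n).contDiff_normed hul _).differentiableAt
      have hcomp : fderiv ℝ (smoothing z hρ n (U.indicator u)) x = _ :=
        (hMd.hasFDerivAt.comp x hc).fderiv
      refine ext_inner_right ℝ fun v => ?_
      rw [gradient, InnerProductSpace.toDual_symm_apply, hcomp]
      simp only [ContinuousLinearMap.comp_apply, smul_apply,
        ContinuousLinearMap.id_apply, map_smul, smul_eq_mul]
      rw [fderiv_convolution_of_isWeakGradient hU hul hGl hw _ hsub, inner_smul_left]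
      simp [smoothing]
    have hlim : Tendsto (fun n : ℕ => eLpNorm (fun x => smoothing z hρ n (U.indicator G) x -
        U.indicator G x) 2 volume + ENNReal.ofReal (1 / ((n : ℝ) + 2)) *
          eLpNorm (U.indicator G) 2 volume) atTop (𝓝 0) := by
      have h1 : Tendsto (fun n : ℕ => ENNReal.ofReal (1 / ((n : ℝ) + 2))) atTop (𝓝 0) := by
        simpa using ENNReal.tendsto_ofReal tendsto_one_div_add_two
      have h2 := ENNReal.Tendsto.mul_const h1 (Or.inr hG'.2.ne)
      have := (tendsto_smoothing z hρ hG').add h2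
      simpa using this
    refine tendsto_of_tendsto_of_tendsto_of_le_of_le tendsto_const_nhds hlim
      (fun _ => zero_le) fun n => ?_
    set r : ℝ := 1 - 1 / ((n : ℝ) + 2) with hr
    have hν : 1 / ((n : ℝ) + 2) ≤ 1 := by
      rw [div_le_one (by positivity)]; linarith [(Nat.cast_nonneg n : (0:ℝ) ≤ n)]
    have hν0 : 0 < 1 / ((n : ℝ) + 2) := by positivity
    have hsm : AEStronglyMeasurable (fun x => smoothing z hρ n (U.indicator G) x -
        U.indicator G x) volume := by
      have hc : Continuous (smoothing z hρ n (U.indicator G)) := by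
        unfold smoothing
        refine Continuous.comp (g := ((mollifier hρ n).normed volume
          ⋆[ContinuousLinearMap.lsmul ℝ ℝ, volume] U.indicator G)) ?_
            (by unfold contraction; fun_prop)
        exact (mollifier hρ n).hasCompactSupport_normed.continuous_convolution_left _
          (mollifier hρ n).continuous_normed hGl
      exact hc.aestronglyMeasurable.sub hG'.1
    calc eLpNorm (fun x => gradient (smoothing z hρ n (U.indicator u)) x - G x) 2
          (volume.restrict U)
        = eLpNorm (r • (fun x => smoothing z hρ n (U.indicator G) x - U.indicator G x) +
            (-(1 / ((n : ℝ) + 2))) • U.indicator G) 2 (volume.restrict U) := by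
          refine eLpNorm_congr_ae ?_
          filter_upwards [ae_restrict_mem hU.measurableSet] with x hx
          rw [hgrad n x hx]
          simp only [Pi.add_apply, Pi.smul_apply, indicator_of_mem hx, hr]
          module
      _ ≤ eLpNorm (r • (fun x => smoothing z hρ n (U.indicator G) x - U.indicator G x) +
            (-(1 / ((n : ℝ) + 2))) • U.indicator G) 2 volume :=
          eLpNorm_mono_measure _ Measure.restrict_le_self
      _ ≤ _ := by
          refine (eLpNorm_add_le (hsm.const_smul r) (hG'.1.const_smul _) (by norm_num)).trans ?_
          rw [eLpNorm_const_smul, eLpNorm_const_smul]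
          gcongr
          · refine mul_le_of_le_one_left' ?_
            rw [Real.enorm_of_nonneg (by linarith), ENNReal.ofReal_le_one]
            linarith
          · rw [enorm_neg, Real.enorm_of_nonneg hν0.le]

/-! ### Existence of traces -/

lemma weakGradient_spec {U : Set Plane} {u : Plane → ℝ} (hu : MemH1 U u) :
    MemLp (weakGradient U u) 2 (volume.restrict U) ∧ IsWeakGradient U u (weakGradient U u) := by
  unfold weakGradient
  rw [dif_pos hu.2]
  exact hu.2.choose_spec

lemma restrict_openTriangle (s : Finset Plane) :
    (volume : Measure Plane).restrict (convexHull ℝ (s : Set Plane)) =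
      volume.restrict (openTriangle s) := by
  refine Measure.restrict_congr_set ?_
  have h := (convex_convexHull ℝ (s : Set Plane)).addHaar_frontier volume
  exact (interior_ae_eq_of_null_frontier h).symm

lemma lintegral_energyDensity {s : Finset Plane} {w : Plane → ℝ} (hw : ContDiff ℝ 1 w) :
    ∫⁻ x in convexHull ℝ (s : Set Plane), energyDensity w x =
      eLpNorm w 2 (volume.restrict (openTriangle s)) ^ 2 +
        eLpNorm (gradient w) 2 (volume.restrict (openTriangle s)) ^ 2 := by
  rw [restrict_openTriangle, eLpNorm_two_sq, eLpNorm_two_sq]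
  exact lintegral_add_left (hw.continuous.measurable.enorm.pow_const 2) _

lemma frontier_openTriangle_subset {s : Finset Plane} {c d q : Plane}
    (hs : (s : Set Plane) = {c, d, q}) (hind : AffineIndependent ℝ ![c, d, q]) :
    frontier (openTriangle s) ⊆ segment ℝ c d ∪ segment ℝ d q ∪ segment ℝ q c := by
  rw [openTriangle, hs]
  exact frontier_interior_triangle_subset hind

lemma arcLength_frontier_lt_top {s : Finset Plane} (h : AffineIndependent ℝ ((↑) : s → Plane))
    (hcard : s.card = 3) : arcLength (frontier (openTriangle s)) < ⊤ := by
  obtain ⟨c, d, q, hs, hind⟩ := exists_vertices h hcard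
  refine (measure_mono (frontier_openTriangle_subset hs hind)).trans_lt ?_
  refine (measure_union_le _ _).trans_lt (ENNReal.add_lt_top.2 ⟨(measure_union_le _ _).trans_lt
    (ENNReal.add_lt_top.2 ⟨?_, ?_⟩), ?_⟩) <;>
  · rw [hausdorffMeasure_segment]; exact edist_lt_top _ _

/-- The trace inequality for a triangle. -/
lemma exists_trace_bound {s : Finset Plane} (h : AffineIndependent ℝ ((↑) : s → Plane))
    (hcard : s.card = 3) :
    ∃ C : ℝ≥0∞, C ≠ ⊤ ∧ ∀ w : Plane → ℝ, ContDiff ℝ 1 w →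
      eLpNorm w 2 (arcLength.restrict (frontier (openTriangle s))) ^ 2 ≤
        C * (eLpNorm w 2 (volume.restrict (openTriangle s)) ^ 2 +
          eLpNorm (gradient w) 2 (volume.restrict (openTriangle s)) ^ 2) := by
  obtain ⟨c, d, q, hs, hind⟩ := exists_vertices h hcard
  set V := volume (convexHull ℝ (s : Set Plane)) with hV
  set D := Metric.diam (convexHull ℝ (s : Set Plane)) with hD
  have hV0 : V ≠ 0 := by
    rw [hV, hs]
    exact (Measure.measure_pos_of_nonempty_interior _ (interior_triangle_nonempty hind)).ne'
  have hdist : ∀ x ∈ (s : Set Plane), ∀ y ∈ (s : Set Plane), dist x y ≤ D := fun x hx y hy =>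
    Triangulation.dist_le_diam hx hy
  have hside : ∀ {c d q : Plane}, AffineIndependent ℝ ![c, d, q] → (s : Set Plane) = {c, d, q} →
      ∀ w : Plane → ℝ, ContDiff ℝ 1 w →
      ∫⁻ x in segment ℝ c d, ‖w x‖ₑ ^ 2 ∂arcLength ≤
        2 * (ENNReal.ofReal D * (V⁻¹ * (ENNReal.ofReal (3 + D ^ 2) *
          ∫⁻ x in convexHull ℝ (s : Set Plane), energyDensity w x))) := by
    intro c d q hind hs w hw
    have hc : c ∈ (s : Set Plane) := by rw [hs]; simp
    have hd : d ∈ (s : Set Plane) := by rw [hs]; simp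
    have hq : q ∈ (s : Set Plane) := by rw [hs]; simp
    have := lintegral_side_le hind hw (hdist c hc q hq) (hdist d hd q hq)
    rw [← hs] at this
    refine this.trans ?_
    gcongr
    exact hdist c hc d hd
  refine ⟨3 * (2 * (ENNReal.ofReal D * (V⁻¹ * ENNReal.ofReal (3 + D ^ 2)))), ?_, ?_⟩
  · have : V⁻¹ ≠ ⊤ := ENNReal.inv_ne_top.2 hV0
    finiteness
  intro w hw
  have h2 := affineIndependent_rotate hind
  have h3 := affineIndependent_rotate h2
  have e2 : (s : Set Plane) = {d, q, c} := by rw [hs]; ext; simp; tauto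
  have e3 : (s : Set Plane) = {q, c, d} := by rw [hs]; ext; simp; tauto
  rw [eLpNorm_two_sq, ← lintegral_energyDensity hw]
  calc ∫⁻ x in frontier (openTriangle s), ‖w x‖ₑ ^ 2 ∂arcLength
      ≤ (∫⁻ x in segment ℝ c d, ‖w x‖ₑ ^ 2 ∂arcLength +
          ∫⁻ x in segment ℝ d q, ‖w x‖ₑ ^ 2 ∂arcLength) +
          ∫⁻ x in segment ℝ q c, ‖w x‖ₑ ^ 2 ∂arcLength := by
        refine (lintegral_mono_set (frontier_openTriangle_subset hs hind)).trans ?_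
        refine (lintegral_union_le _ _ _).trans (add_le_add_left (lintegral_union_le _ _ _) _)
    _ ≤ _ := add_le_add (add_le_add (hside hind hs w hw) (hside h2 e2 w hw)) (hside h3 e3 w hw)
    _ = _ := by ring

/-- Every `H¹` function on a triangle has a trace. -/
lemma isTrace_trace {s : Finset Plane} (h : AffineIndependent ℝ ((↑) : s → Plane))
    (hcard : s.card = 3) {u : Plane → ℝ} (hu : MemH1 (openTriangle s) u) :
    IsTrace (openTriangle s) u (trace (openTriangle s) u) := by
  suffices hex : ∃ g, IsTrace (openTriangle s) u g by
    unfold trace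
    rw [dif_pos hex]
    exact hex.choose_spec
  set U := openTriangle s with hU
  obtain ⟨hG, hweak⟩ := weakGradient_spec hu
  have hne : U.Nonempty := by
    obtain ⟨c, d, q, hs, hind⟩ := exists_vertices h hcard
    rw [hU, openTriangle, hs]
    exact interior_triangle_nonempty hind
  obtain ⟨w, hw, hwu, hwG⟩ := exists_smooth_approx (U := U) isOpen_interior
    (convex_convexHull ℝ (s : Set Plane)).interior hne hu.1 hG hweak
  have hw1 : ∀ n, ContDiff ℝ 1 (w n) := fun n => (hw n).of_le (by norm_cast)
  set μ := arcLength.restrict (frontier U) with hμ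
  have hfin : IsFiniteMeasure μ := ⟨by
    rw [hμ, Measure.restrict_apply_univ]; exact arcLength_frontier_lt_top h hcard⟩
  have hcomp : IsCompact (frontier U) := by
    refine (Triangulation.isCompact_convexHull s).of_isClosed_subset isClosed_frontier ?_
    refine frontier_subset_closure.trans (closure_minimal interior_subset ?_)
    exact (Triangulation.isCompact_convexHull s).isClosed
  have hmem : ∀ n, MemLp (w n) 2 μ := by
    intro n
    obtain ⟨B, hB⟩ := hcomp.exists_bound_of_continuousOn (hw n).continuous.continuousOn
    refine MemLp.of_bound (hw n).continuous.aestronglyMeasurable B ?_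
    filter_upwards [ae_restrict_mem isClosed_frontier.measurableSet] with x hx using hB x hx
  obtain ⟨C, hC, hbound⟩ := exists_trace_bound h hcard
  set a : ℕ → ℝ≥0∞ := fun n => eLpNorm (fun x => w n x - u x) 2 (volume.restrict U) +
    eLpNorm (fun x => gradient (w n) x - weakGradient U u x) 2 (volume.restrict U) with ha
  have ha0 : Tendsto a atTop (𝓝 0) := by simpa using hwu.add hwG
  -- The trace inequality on the triangle, applied to `w n - w m`, transfers the Cauchy property
  -- from `H¹` to the boundary values.
  have hcau : ∀ n m, eLpNorm (w n - w m) 2 μ ^ 2 ≤ C * (2 * (a n + a m) ^ 2) := by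
    intro n m
    refine (hbound _ ((hw1 n).sub (hw1 m))).trans (mul_le_mul_right ?_ _)
    have hgrad : gradient (w n - w m) = gradient (w n) - gradient (w m) := by
      ext1 x
      simp only [gradient, Pi.sub_apply]
      rw [fderiv_sub ((hw1 n).differentiable one_ne_zero x)
        ((hw1 m).differentiable one_ne_zero x), map_sub]
    have t1 : eLpNorm (w n - w m) 2 (volume.restrict U) ≤ a n + a m := by
      have e : w n - w m = (fun x => w n x - u x) - fun x => w m x - u x := by
        ext x; simp
      rw [e]
      refine (eLpNorm_sub_le ((hw n).continuous.aestronglyMeasurable.sub hu.1.1)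
        ((hw m).continuous.aestronglyMeasurable.sub hu.1.1) (by norm_num)).trans ?_
      exact add_le_add le_self_add le_self_add
    have t2 : eLpNorm (gradient (w n - w m)) 2 (volume.restrict U) ≤ a n + a m := by
      have e : gradient (w n - w m) = (fun x => gradient (w n) x - weakGradient U u x) -
          fun x => gradient (w m) x - weakGradient U u x := by
        rw [hgrad]; ext1 x; simp
      rw [e]
      refine (eLpNorm_sub_le ((continuous_gradient (hw1 n)).aestronglyMeasurable.sub hG.1)
        ((continuous_gradient (hw1 m)).aestronglyMeasurable.sub hG.1) (by norm_num)).trans ?_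
      exact add_le_add le_add_self le_add_self
    rw [two_mul]
    exact add_le_add (pow_le_pow_left' t1 2) (pow_le_pow_left' t2 2)
  let F : ℕ → Lp ℝ 2 μ := fun n => (hmem n).toLp (w n)
  have hF : CauchySeq F := by
    rw [EMetric.cauchySeq_iff]
    intro ε hε
    have hlim : Tendsto (fun p : ℕ × ℕ => C * (2 * (a p.1 + a p.2) ^ 2)) atTop (𝓝 0) := by
      have h1 : Tendsto (fun p : ℕ × ℕ => a p.1 + a p.2) atTop (𝓝 0) := by
        rw [← prod_atTop_atTop_eq]
        simpa using (ha0.comp tendsto_fst).add (ha0.comp tendsto_snd)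
      have h2 := ENNReal.Tendsto.const_mul (ENNReal.Tendsto.const_mul (ENNReal.Tendsto.pow (n := 2) h1)
        (Or.inr (by norm_num : (2:ℝ≥0∞) ≠ ⊤))) (Or.inr hC)
      simpa using h2
    have hε2 : 0 < ε ^ 2 := by positivity
    obtain ⟨N, hN⟩ := eventually_atTop.1 (hlim.eventually_lt_const hε2)
    refine ⟨max N.1 N.2, fun m hm n hn => ?_⟩
    rw [Lp.edist_toLp_toLp]
    have := (hcau m n).trans_lt
      (hN (m, n) ⟨(le_max_left _ _).trans hm, (le_max_right _ _).trans hn⟩)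
    exact lt_of_not_ge fun h => this.not_ge (pow_le_pow_left' h 2)
  obtain ⟨g, hg⟩ := cauchySeq_tendsto_of_complete hF
  refine ⟨g, Lp.memLp g, w, hw, hwu, hwG, ?_⟩
  have hg' : Tendsto (fun n => (hmem n).toLp (w n)) atTop (𝓝 ((Lp.memLp g).toLp g)) := by
    rw [Lp.toLp_coeFn]; exact hg
  exact (Lp.tendsto_Lp_iff_tendsto_eLpNorm'' w hmem g (Lp.memLp g)).1 hg'

/-! ### Passage to the limit -/

lemma tendsto_eLpNorm_of_tendsto_sub {α F : Type*} [MeasurableSpace α] [NormedAddCommGroup F]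
    {μ : Measure α} {f : ℕ → α → F} {g : α → F} (hf : ∀ n, AEStronglyMeasurable (f n) μ)
    (hg : MemLp g 2 μ) (h : Tendsto (fun n => eLpNorm (fun x => f n x - g x) 2 μ) atTop (𝓝 0)) :
    Tendsto (fun n => eLpNorm (f n) 2 μ) atTop (𝓝 (eLpNorm g 2 μ)) := by
  have hup : Tendsto (fun n => eLpNorm g 2 μ + eLpNorm (fun x => f n x - g x) 2 μ) atTop
      (𝓝 (eLpNorm g 2 μ)) := by simpa using h.const_add (eLpNorm g 2 μ)
  have hlow : Tendsto (fun n => eLpNorm g 2 μ - eLpNorm (fun x => f n x - g x) 2 μ) atTop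
      (𝓝 (eLpNorm g 2 μ)) := by
    simpa using ENNReal.Tendsto.sub tendsto_const_nhds h (Or.inl hg.2.ne)
  refine tendsto_of_tendsto_of_tendsto_of_le_of_le hlow hup (fun n => ?_) fun n => ?_
  · rw [tsub_le_iff_right]
    have e : g = f n - fun x => f n x - g x := by ext1 x; simp
    calc eLpNorm g 2 μ = eLpNorm (f n - fun x => f n x - g x) 2 μ := by rw [← e]
      _ ≤ _ := eLpNorm_sub_le (hf n) ((hf n).sub hg.1) (by norm_num)
  · have e : f n = g + fun x => f n x - g x := by ext1 x; simp
    calc eLpNorm (f n) 2 μ = eLpNorm (g + fun x => f n x - g x) 2 μ := by rw [← e]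
      _ ≤ _ := eLpNorm_add_le hg.1 ((hf n).sub hg.1) (by norm_num)

lemma ofReal_integral_norm_sq {α F : Type*} [MeasurableSpace α] [NormedAddCommGroup F]
    {μ : Measure α} {g : α → F} (hg : MemLp g 2 μ) :
    ENNReal.ofReal (∫ x, ‖g x‖ ^ 2 ∂μ) = eLpNorm g 2 μ ^ 2 := by
  rw [eLpNorm_two_sq, ofReal_integral_eq_lintegral_ofReal
    ((memLp_two_iff_integrable_sq_norm hg.1).1 hg) (Eventually.of_forall fun x => by positivity)]
  refine lintegral_congr fun x => ?_
  rw [ENNReal.ofReal_pow (norm_nonneg _), ofReal_norm]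

namespace Triangulation

variable {Ω : Set Plane} (T : Triangulation Ω)

lemma frontier_inter_convexHull_subset (hΩ : interior (closure Ω) = Ω) {s : Finset Plane}
    (hs : s ∈ T.elements) :
    convexHull ℝ (s : Set Plane) ∩ frontier Ω ⊆ frontier (openTriangle s) := by
  obtain ⟨c, d, q, hq, hind⟩ := exists_vertices (T.affineIndependent hs) (T.mem_elements.1 hs).2
  have hdis := frontier_inter_interior hΩ (T.convexHull_subset_closure hs)
  rw [openTriangle, hq, frontier_interior_triangle hind, ← hq]
  exact fun x hx => ⟨hx.1, fun h => hdis.le_bot ⟨hx.2, h⟩⟩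

lemma edge_subset_frontier {e s : Finset Plane} (he : e.card = 2) (hs : s ∈ T.elementsAt e) :
    convexHull ℝ (e : Set Plane) ⊆ frontier (openTriangle s) := by
  rw [mem_elementsAt] at hs
  obtain ⟨c, d, hcd, rfl⟩ := Finset.card_eq_two.1 he
  obtain ⟨q, hq, hind⟩ := exists_third_vertex (T.affineIndependent hs.1) (T.mem_elements.1 hs.1).2
    (hs.2 (by simp)) (hs.2 (by simp)) hcd
  rw [openTriangle, hq, Finset.coe_pair, convexHull_pair]
  exact segment_subset_frontier hind

lemma diam_pos {e : Finset Plane} (he : e ∈ T.interiorEdges) :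
    0 < Metric.diam (e : Set Plane) := by
  obtain ⟨c, d, hcd, rfl⟩ := Finset.card_eq_two.1 (T.card_of_mem_interiorEdges he)
  rw [Finset.coe_pair, Metric.diam_pair]
  exact dist_pos.2 hcd

/-- The part of the energy of a piecewise `H¹` function that belongs to the elements. -/
lemma sum_elements_le {u : Plane → ℝ} (hu : T.MemH1h u)
    (hΩ' : interior (closure Ω) = Ω) :
    ∑ s ∈ T.elements, (eLpNorm u 2 (volume.restrict (openTriangle s)) ^ 2 +
        eLpNorm (weakGradient (openTriangle s) u) 2 (volume.restrict (openTriangle s)) ^ 2) ≤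
      ENNReal.ofReal ((∫ x in Ω, u x ^ 2) +
        ∑ s ∈ T.elements, ∫ x in openTriangle s, ‖weakGradient (openTriangle s) u x‖ ^ 2) := by
  have hsub : ∀ s ∈ T.elements, openTriangle s ⊆ Ω := fun s hs => by
    rw [← hΩ']; exact interior_mono (T.convexHull_subset_closure hs)
  have hint : ∀ s ∈ T.elements, IntegrableOn (fun x => u x ^ 2) (openTriangle s) volume :=
    fun s hs => (hu s hs).1.integrable_sq
  set W := ⋃ s ∈ T.elements, openTriangle s with hW
  have hWΩ : W ⊆ Ω := iUnion₂_subset hsub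
  -- The closed elements cover `Ω`, and the boundaries of convex sets are null.
  have hae : W =ᵐ[volume] Ω := by
    refine (LE.le.eventuallyLE hWΩ).antisymm ?_
    have hnull : volume (⋃ s ∈ T.elements, frontier (convexHull ℝ (s : Set Plane))) = 0 :=
      (measure_biUnion_null_iff T.elements.countable_toSet).2 fun s _ =>
        (convex_convexHull ℝ (s : Set Plane)).addHaar_frontier volume
    filter_upwards [measure_eq_zero_iff_ae_notMem.1 hnull] with x hx hxΩ
    have := subset_closure hxΩ
    rw [T.closure_eq, mem_iUnion₂] at this
    obtain ⟨s, hs, hxs⟩ := this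
    refine mem_biUnion hs ?_
    by_contra hcon
    refine hx (mem_biUnion hs ?_)
    rw [(isCompact_convexHull s).isClosed.frontier_eq]
    exact ⟨hxs, hcon⟩
  have hL2 : ∑ s ∈ T.elements, ∫ x in openTriangle s, u x ^ 2 = ∫ x in Ω, u x ^ 2 := by
    rw [← setIntegral_congr_set hae, hW, integral_biUnion_finset]
    · exact fun s _ => isOpen_interior.measurableSet
    · exact fun s hs t ht hst => T.disjoint_openTriangle hs ht hst
    · exact hint
  rw [← hL2, ← Finset.sum_add_distrib, ENNReal.ofReal_sum_of_nonneg]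
  · refine Finset.sum_le_sum fun s hs => ?_
    rw [ENNReal.ofReal_add (integral_nonneg fun x => by positivity)
      (integral_nonneg fun x => by positivity), ofReal_integral_norm_sq (weakGradient_spec (hu s hs)).1,
      ← ofReal_integral_norm_sq (hu s hs).1]
    simp
  · exact fun s _ => add_nonneg (integral_nonneg fun x => by positivity)
      (integral_nonneg fun x => by positivity)

/-- The part of the energy of a piecewise `H¹` function that belongs to the interior edges. -/
lemma jumpEnergy_trace_eq {u : Plane → ℝ} (hu : T.MemH1h u) :
    T.jumpEnergy (fun s => trace (openTriangle s) u) =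
      ENNReal.ofReal (2 * ∑ e ∈ T.interiorEdges, (1 / Metric.diam (e : Set Plane)) *
        ∫ x in convexHull ℝ (e : Set Plane), T.jumpSq u e x ∂arcLength) := by
  have hnn : ∀ e x, 0 ≤ T.jumpSq u e x := fun e x => by unfold jumpSq; positivity
  rw [Finset.mul_sum, ENNReal.ofReal_sum_of_nonneg, jumpEnergy]
  · refine Finset.sum_congr rfl fun e he => ?_
    have he2 := T.card_of_mem_interiorEdges he
    have hδ := T.diam_pos he
    set μ := arcLength.restrict (convexHull ℝ (e : Set Plane)) with hμ
    have hm : ∀ k ∈ T.elementsAt e, MemLp (trace (openTriangle k) u) 2 μ := by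
      intro k hk
      have hk' := (T.mem_elementsAt.1 hk).1
      exact (isTrace_trace (T.affineIndependent hk') (T.mem_elements.1 hk').2 (hu k hk')).1.mono_measure
        (Measure.restrict_mono (T.edge_subset_frontier he2 hk) le_rfl)
    have hi : ∀ k ∈ T.elementsAt e, ∀ l ∈ T.elementsAt e, Integrable
        (fun x => (trace (openTriangle k) u x - trace (openTriangle l) u x) ^ 2) μ :=
      fun k hk l hl => ((hm k hk).sub (hm l hl)).integrable_sq
    -- The factor `2` cancels the `1 / 2` in `jumpSq`, since `jumpEnergy` counts each ordered pair
    -- of elements.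
    have h1 : 2 * ∫ x, T.jumpSq u e x ∂μ = ∑ k ∈ T.elementsAt e, ∑ l ∈ T.elementsAt e,
        ∫ x, (trace (openTriangle k) u x - trace (openTriangle l) u x) ^ 2 ∂μ := by
      unfold jumpSq
      rw [integral_const_mul, integral_finsetSum _ fun k hk => integrable_finsetSum _ (hi k hk)]
      rw [← mul_assoc, show (2:ℝ) * (1 / 2) = 1 by norm_num, one_mul]
      exact Finset.sum_congr rfl fun k hk => integral_finsetSum _ (hi k hk)
    have h2 : 2 * (1 / Metric.diam (e : Set Plane) * ∫ x, T.jumpSq u e x ∂μ) =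
        (Metric.diam (e : Set Plane))⁻¹ * (2 * ∫ x, T.jumpSq u e x ∂μ) := by
      rw [one_div]; ring
    rw [h2, ENNReal.ofReal_mul (by positivity), ENNReal.ofReal_inv_of_pos hδ, h1,
      ENNReal.ofReal_sum_of_nonneg fun k _ => Finset.sum_nonneg fun l _ =>
        integral_nonneg fun x => by positivity]
    congr 1
    refine Finset.sum_congr rfl fun k hk => ?_
    rw [ENNReal.ofReal_sum_of_nonneg fun l _ => integral_nonneg fun x => by positivity]
    refine Finset.sum_congr rfl fun l hl => ?_
    have := ofReal_integral_norm_sq ((hm k hk).sub (hm l hl))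
    rw [eLpNorm_two_sq] at this
    simpa using this.symm
  · intro e _
    have : 0 ≤ ∫ x in convexHull ℝ (e : Set Plane), T.jumpSq u e x ∂arcLength :=
      integral_nonneg (hnn e)
    have := Metric.diam_nonneg (s := (e : Set Plane))
    positivity

/-- The trace inequality for piecewise `H¹` functions, in terms of extended nonnegative reals. -/
lemma memLp_and_eLpNorm_boundaryTrace_le (hΩ : interior (closure Ω) = Ω)
    {C : ℝ≥0∞} (hC : C ≠ ⊤)
    (hbound : ∀ w : Finset Plane → Plane → ℝ, (∀ s, ContDiff ℝ 1 (w s)) →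
      ∫⁻ x in frontier Ω, ‖T.piecewise w x‖ₑ ^ 2 ∂arcLength ≤
        C * (T.elementEnergy w + T.jumpEnergy w)) {u : Plane → ℝ} (hu : T.MemH1h u) :
    MemLp (T.boundaryTrace u) 2 (arcLength.restrict (frontier Ω)) ∧
    eLpNorm (T.boundaryTrace u) 2 (arcLength.restrict (frontier Ω)) ^ 2 ≤
      C * (∑ s ∈ T.elements, (eLpNorm u 2 (volume.restrict (openTriangle s)) ^ 2 +
        eLpNorm (weakGradient (openTriangle s) u) 2 (volume.restrict (openTriangle s)) ^ 2) +
        T.jumpEnergy (fun s => trace (openTriangle s) u)) := by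
  set g : Finset Plane → Plane → ℝ := fun s => trace (openTriangle s) u with hg
  have htr : ∀ s ∈ T.elements, IsTrace (openTriangle s) u (g s) := fun s hs =>
    isTrace_trace (T.affineIndependent hs) (T.mem_elements.1 hs).2 (hu s hs)
  -- The approximations are those that come with the chosen trace, so uniqueness of the trace is not
  -- needed. Vertex sets that are not elements get the zero function, as smoothness is asked for
  -- every `s`.
  have hex : ∀ s, ∃ w : ℕ → Plane → ℝ, (∀ n, ContDiff ℝ ∞ (w n)) ∧ (s ∈ T.elements →
      Tendsto (fun n => eLpNorm (fun x => w n x - u x) 2 (volume.restrict (openTriangle s)))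
        atTop (𝓝 0) ∧
      Tendsto (fun n => eLpNorm (fun x => gradient (w n) x - weakGradient (openTriangle s) u x) 2
        (volume.restrict (openTriangle s))) atTop (𝓝 0) ∧
      Tendsto (fun n => eLpNorm (fun x => w n x - g s x) 2
        (arcLength.restrict (frontier (openTriangle s)))) atTop (𝓝 0)) := by
    intro s
    by_cases hs : s ∈ T.elements
    · obtain ⟨-, w, hw, h⟩ := htr s hs
      exact ⟨w, hw, fun _ => h⟩
    · exact ⟨0, fun _ => contDiff_const, fun h => absurd h hs⟩
  choose w hw hlim using hex
  have hw1 : ∀ s n, ContDiff ℝ 1 (w s n) := fun s n => (hw s n).of_le (by norm_cast)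
  have hwm : ∀ (s n) (μ : Measure Plane), AEStronglyMeasurable (w s n) μ := fun s n μ =>
    (hw s n).continuous.aestronglyMeasurable
  set ν := arcLength.restrict (frontier Ω) with hν
  -- On a closed element, `∂Ω` is part of the boundary of that element, so convergence on the latter
  -- controls convergence on `∂Ω`.
  have hle : ∀ s ∈ T.elements, ν.restrict (convexHull ℝ (s : Set Plane)) ≤
      arcLength.restrict (frontier (openTriangle s)) := by
    intro s hs
    rw [hν, Measure.restrict_restrict (measurableSet_convexHull s)]
    exact Measure.restrict_mono (T.frontier_inter_convexHull_subset hΩ hs) le_rfl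
  have hgind : ∀ s ∈ T.elements,
      MemLp ((convexHull ℝ (s : Set Plane)).indicator (g s)) 2 ν := fun s hs =>
    (memLp_indicator_iff_restrict (measurableSet_convexHull s)).2
      ((htr s hs).1.mono_measure (hle s hs))
  have hbt : MemLp (T.boundaryTrace u) 2 ν := memLp_finsetSum T.elements hgind
  refine ⟨hbt, ?_⟩
  have hpm : ∀ n, AEStronglyMeasurable (T.piecewise fun s => w s n) ν := by
    intro n
    unfold piecewise
    exact Finset.aestronglyMeasurable_fun_sum _ fun s _ =>
      (hwm s n ν).indicator (measurableSet_convexHull s)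
  have hleft : Tendsto (fun n => eLpNorm (T.piecewise fun s => w s n) 2 ν ^ 2) atTop
      (𝓝 (eLpNorm (T.boundaryTrace u) 2 ν ^ 2)) := by
    refine ENNReal.Tendsto.pow (tendsto_eLpNorm_of_tendsto_sub hpm hbt ?_)
    have h0 : Tendsto (fun n => ∑ s ∈ T.elements, eLpNorm (fun x => w s n x - g s x) 2
        (arcLength.restrict (frontier (openTriangle s)))) atTop (𝓝 0) := by
      have := tendsto_finsetSum T.elements fun s hs => (hlim s hs).2.2
      simpa using this
    refine tendsto_of_tendsto_of_tendsto_of_le_of_le tendsto_const_nhds h0 (fun _ => zero_le)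
      fun n => ?_
    have e : (fun x => T.piecewise (fun s => w s n) x - T.boundaryTrace u x) =
        ∑ s ∈ T.elements,
          (convexHull ℝ (s : Set Plane)).indicator (fun x => w s n x - g s x) := by
      ext x
      simp only [piecewise, boundaryTrace, Finset.sum_apply, ← Finset.sum_sub_distrib]
      refine Finset.sum_congr rfl fun s _ => ?_
      by_cases hx : x ∈ convexHull ℝ (s : Set Plane) <;> simp [hx, hg]
    rw [e]
    refine (eLpNorm_sum_le (fun s hs => ?_) (by norm_num)).trans (Finset.sum_le_sum fun s hs => ?_)
    · rw [aestronglyMeasurable_indicator_iff (measurableSet_convexHull s)]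
      exact (hwm s n _).sub ((htr s hs).1.mono_measure (hle s hs)).1
    · rw [eLpNorm_indicator_eq_eLpNorm_restrict (measurableSet_convexHull s)]
      exact eLpNorm_mono_measure _ (hle s hs)
  have hE : Tendsto (fun n => T.elementEnergy fun s => w s n) atTop
      (𝓝 (∑ s ∈ T.elements, (eLpNorm u 2 (volume.restrict (openTriangle s)) ^ 2 +
        eLpNorm (weakGradient (openTriangle s) u) 2 (volume.restrict (openTriangle s)) ^ 2))) := by
    unfold elementEnergy
    refine tendsto_finsetSum _ fun s hs => ?_
    simp only [lintegral_energyDensity (hw1 s _)]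
    refine Tendsto.add (ENNReal.Tendsto.pow ?_) (ENNReal.Tendsto.pow ?_)
    · exact tendsto_eLpNorm_of_tendsto_sub (fun n => hwm s n _) (hu s hs).1 (hlim s hs).1
    · exact tendsto_eLpNorm_of_tendsto_sub
        (fun n => (continuous_gradient (hw1 s n)).aestronglyMeasurable)
        (weakGradient_spec (hu s hs)).1 (hlim s hs).2.1
  have hJ : Tendsto (fun n => T.jumpEnergy fun s => w s n) atTop (𝓝 (T.jumpEnergy g)) := by
    unfold jumpEnergy
    refine tendsto_finsetSum _ fun e he => ?_
    refine ENNReal.Tendsto.const_mul ?_ (Or.inr (ENNReal.inv_ne_top.2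
      (ENNReal.ofReal_pos.2 (T.diam_pos he)).ne'))
    refine tendsto_finsetSum _ fun k hk => tendsto_finsetSum _ fun l hl => ?_
    simp only [← eLpNorm_two_sq]
    have he2 := T.card_of_mem_interiorEdges he
    have hmono : ∀ k ∈ T.elementsAt e, arcLength.restrict (convexHull ℝ (e : Set Plane)) ≤
        arcLength.restrict (frontier (openTriangle k)) := fun k hk =>
      Measure.restrict_mono (T.edge_subset_frontier he2 hk) le_rfl
    have hk' := (T.mem_elementsAt.1 hk).1
    have hl' := (T.mem_elementsAt.1 hl).1
    have hgk := (htr k hk').1.mono_measure (hmono k hk)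
    have hgl := (htr l hl').1.mono_measure (hmono l hl)
    refine ENNReal.Tendsto.pow (tendsto_eLpNorm_of_tendsto_sub
      (fun n => (hwm k n _).sub (hwm l n _)) (hgk.sub hgl) ?_)
    have h0 := (hlim k hk').2.2.add (hlim l hl').2.2
    rw [add_zero] at h0
    refine tendsto_of_tendsto_of_tendsto_of_le_of_le tendsto_const_nhds h0 (fun _ => zero_le)
      fun n => ?_
    have e1 : (fun x => w k n x - w l n x - (g k x - g l x)) =
        (fun x => w k n x - g k x) - fun x => w l n x - g l x := by
      ext x; simp only [Pi.sub_apply]; ring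
    rw [e1]
    refine (eLpNorm_sub_le ((hwm k n _).sub hgk.1) ((hwm l n _).sub hgl.1) (by norm_num)).trans ?_
    exact add_le_add (eLpNorm_mono_measure _ (hmono k hk)) (eLpNorm_mono_measure _ (hmono l hl))
  refine le_of_tendsto_of_tendsto' hleft (ENNReal.Tendsto.const_mul (hE.add hJ) (Or.inr hC))
    fun n => ?_
  rw [eLpNorm_two_sq]
  exact hbound _ fun s => hw1 s n

lemma H1hNorm_sq (u : Plane → ℝ) :
    T.H1hNorm u ^ 2 = (∫ x in Ω, u x ^ 2)
      + (∑ s ∈ T.elements, ∫ x in openTriangle s, ‖weakGradient (openTriangle s) u x‖ ^ 2)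
      + ∑ e ∈ T.interiorEdges, (1 / Metric.diam (e : Set Plane)) *
          ∫ x in convexHull ℝ (e : Set Plane), T.jumpSq u e x ∂arcLength := by
  have h1 : 0 ≤ ∫ x in Ω, u x ^ 2 := integral_nonneg fun x => by positivity
  have h2 : 0 ≤ ∑ s ∈ T.elements, ∫ x in openTriangle s,
      ‖weakGradient (openTriangle s) u x‖ ^ 2 :=
    Finset.sum_nonneg fun s _ => integral_nonneg fun x => by positivity
  have h3 : 0 ≤ ∑ e ∈ T.interiorEdges, (1 / Metric.diam (e : Set Plane)) *
      ∫ x in convexHull ℝ (e : Set Plane), T.jumpSq u e x ∂arcLength :=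
    Finset.sum_nonneg fun e _ => mul_nonneg (one_div_nonneg.2 Metric.diam_nonneg)
      (integral_nonneg fun x => by unfold jumpSq; positivity)
  unfold H1hNorm
  rw [Real.sq_sqrt (by linarith)]

end Triangulation

/-- The trace inequality with a constant that is uniform for the triangulations of `Ω` whose shape
regularity constants are at most `κ`, provided that `Ω` has a triangulation at all. -/
lemma exists_trace_constant {Ω : Set Plane} (hΩ : IsPolygonalDomain Ω) (κ : ℝ)
    (T₀ : Triangulation Ω) :
    ∃ C : ℝ, ∀ T : Triangulation Ω, T.shapeRegularity ≤ κ →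
      ∀ u : Plane → ℝ, T.MemH1h u →
        MemLp (T.boundaryTrace u) 2 (arcLength.restrict (frontier Ω)) ∧
          T.boundaryNorm u ≤ C * T.H1hNorm u := by
  obtain ⟨C, hC, hbound⟩ := hasBoundaryBound_frontier hΩ.interior_closure hΩ.isBounded κ T₀
  -- The `2` comes from `jumpEnergy`, which is twice the jump part of the squared norm.
  refine ⟨√(2 * C.toReal), fun T hT u hu => ?_⟩
  have hb : ∀ w : Finset Plane → Plane → ℝ, (∀ s, ContDiff ℝ 1 (w s)) →
      ∫⁻ x in frontier Ω, ‖T.piecewise w x‖ₑ ^ 2 ∂arcLength ≤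
        C * (T.elementEnergy w + T.jumpEnergy w) := fun w hw => by
    have := hbound T hT w hw
    rwa [inter_self] at this
  obtain ⟨hmem, hle⟩ := T.memLp_and_eLpNorm_boundaryTrace_le hΩ.interior_closure hC hb hu
  refine ⟨hmem, ?_⟩
  have h1 := T.sum_elements_le hu hΩ.interior_closure
  have h2 := T.jumpEnergy_trace_eq hu
  have hN := T.H1hNorm_sq u
  have hN0 : 0 ≤ T.H1hNorm u := Real.sqrt_nonneg _
  have hS : eLpNorm (T.boundaryTrace u) 2 (arcLength.restrict (frontier Ω)) ^ 2 ≤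
      C * ENNReal.ofReal (2 * T.H1hNorm u ^ 2) := by
    refine hle.trans (mul_le_mul_right ?_ _)
    rw [h2]
    refine (add_le_add_left h1 _).trans ?_
    have a1 : 0 ≤ (∫ x in Ω, u x ^ 2) +
        ∑ s ∈ T.elements, ∫ x in openTriangle s, ‖weakGradient (openTriangle s) u x‖ ^ 2 :=
      add_nonneg (integral_nonneg fun x => by positivity)
        (Finset.sum_nonneg fun s _ => integral_nonneg fun x => by positivity)
    have a2 : 0 ≤ ∑ e ∈ T.interiorEdges, (1 / Metric.diam (e : Set Plane)) *
        ∫ x in convexHull ℝ (e : Set Plane), T.jumpSq u e x ∂arcLength :=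
      Finset.sum_nonneg fun e _ => mul_nonneg (one_div_nonneg.2 Metric.diam_nonneg)
        (integral_nonneg fun x => by unfold Triangulation.jumpSq; positivity)
    rw [← ENNReal.ofReal_add a1 (by linarith)]
    apply ENNReal.ofReal_le_ofReal
    rw [hN]
    linarith
  have hreal : T.boundaryNorm u ^ 2 ≤ 2 * C.toReal * T.H1hNorm u ^ 2 := by
    have := ENNReal.toReal_mono (ENNReal.mul_ne_top hC ENNReal.ofReal_ne_top) hS
    rw [ENNReal.toReal_pow, ENNReal.toReal_mul, ENNReal.toReal_ofReal (by positivity)] at this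
    unfold Triangulation.boundaryNorm
    linarith
  refine abs_le_of_sq_le_sq' ?_ (by positivity) |>.2
  rw [mul_pow, Real.sq_sqrt (by positivity)]
  exact hreal

end PiecewiseH1

end

open PiecewiseH1 in
/-- Trace theorem for piecewise `H¹` functions: the trace on `∂Ω` is square integrable, and its
`L²(∂Ω)` norm is bounded by the piecewise `H¹` norm, with a constant that depends only on `Ω` and
on a bound `κ` of the shape regularity constant. -/
theorem theorem2p1 (Ω : Set Plane) (hΩ : IsPolygonalDomain Ω) (κ : ℝ) :
    ∃ C : ℝ, ∀ T : Triangulation Ω, T.shapeRegularity ≤ κ →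
      ∀ u : Plane → ℝ, T.MemH1h u →
        MemLp (T.boundaryTrace u) 2 (arcLength.restrict (frontier Ω)) ∧
          T.boundaryNorm u ≤ C * T.H1hNorm u := by
  -- The constant is built from a reference triangulation; if there is none, the claim is vacuous.
  rcases isEmpty_or_nonempty (Triangulation Ω) with h | ⟨⟨T₀⟩⟩
  · exact ⟨0, fun T => h.elim T⟩
  · exact exists_trace_constant hΩ κ T₀
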